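/- Let $Y\subseteq\mathbb R^{d'}$ be closed and convex, $f:\mathbb R^d\times Y\to\mathbb R$, $P(x)=\max_{y\in Y}f(x,y)$ and $\mathrm{Gap}(x,y)=\max_{y'\in Y}f(x,y')-\min_{x'\in\mathbb R^d}f(x',y)$. A differentiable $h:\mathbb R^d\to\mathbb R$ satisfies the $\lambda$-PL condition if it has a global minimum and $\|\nabla h(x)\|^2\ge 2\lambda(h(x)-\min h)$ for all $x$. Let $\mu,\mu_x,\mu_y,\rho,B>0$ and $\varepsilon_0\ge 0$, and assume: (i) $f$ is differentiable in $x$ and in $y$ on $\mathbb R^d\times Y$, and $F=(\nabla_xf,-\nabla_yf)$ is $\ell$-Lipschitz there (Euclidean norms); (ii) $f(x,\cdot)$ is $\mu_y$-strongly concave on $Y$ for every $x$; (iii) $P$ is differentiable with $L$-Lipschitz gradient and has a minimizer; (iv) $x_0\in\mathbb R^d$ and $y_0\in Y$ satisfy $\mathrm{Gap}(x_0,y_0)\le\varepsilon_0$; (v) $P$ satisfies the $\mu$-PL condition; (vi) $f(\cdot,y)$ satisfies the $\mu_x$-PL condition for every $y\in Y$; (vii) $f(\cdot,y)$ is $\rho$-weakly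 convex for every $y\in Y$, i.e. $f(x,y)-f(x',y)\ge\langle\nabla_xf(x',y),x-x'\rangle-\frac\rho2\|x-x'\|^2$ for all $x,x'$, where $\rho\le\ell$ and $\rho\le\mu/8$. Stochastic gradients $\nabla_xf(x,y;\xi)$, $\nabla_yf(x,y;\xi)$ are available at independent samples $\xi$; they are unbiased for $\nabla_xf(x,y)$, $\nabla_yf(x,y)$ at every $(x,y)\in\mathbb R^d\times Y$. The proximal epoch method with stochastic gradient descent ascent (SGDA) updates has parameters $\gamma=\mu/4$, $0<\eta_0\le 1/\rho$, $$\eta_k=\eta_0e^{-(k-1)/16},\qquad T_k=\Big\lceil\frac{768}{\eta_0\min\{\mu/8,\mu_y\}}e^{(k-1)/16}\Big\rceil .$$ Epoch $k=1,2,\dots$ starts at $z_0^k=(x_0^k,y_0^k)=(x_{k-1},y_{k-1})$ and computes, for $t=1,\dots,T_k$, $$z_t^k=\arg\min_{z=(x,y)\in\mathbb R^d\times Y}\ \eta_k\langle\mathcal G(z_{t-1}^k;\xi_{t-1}^k),z\rangle+\tfrac12\|z-z_{t-1}^k\|^2+\tfrac{\gamma\eta_k}2\|x-x_0^k\|^2,\qquad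 \mathcal G=(\nabla_xf(\cdot;\xi),-\nabla_yf(\cdot;\xi)),$$ and outputs $(x_k,y_k)=\frac1{T_k}\sum_{t=1}^{T_k}z_t^k$. Assume $\mathbb E\|\nabla_xf(z_t^k;\xi_t^k)\|^2\le B^2$ and $\mathbb E\|\nabla_yf(z_t^k;\xi_t^k)\|^2\le B^2$ for all $k\ge1$ and $0\le t\le T_k$ (for instance, because $\|\nabla_xf(x,y;\xi)\|^2\le B^2$ and $\|\nabla_yf(x,y;\xi)\|^2\le B^2$ everywhere). Then an $\varepsilon$-duality gap is reached in $\widetilde O\big((\mu/\mu_x+1)B^2/(\min\{\mu,\mu_y\}\varepsilon)\big)$ iterations. Precisely, there is an absolute constant $C>0$ such that for all $\mu,\mu_x,\mu_y,\rho,B,\varepsilon_0,\eta_0$ as above there is $\bar\varepsilon>0$ such that for every $\varepsilon>0$ there is a number of epochs $K$, depending only on these parameters and $\varepsilon$, for which every problem and oracle as above satisfy that $\mathrm{Gap}(x_K,y_K)$ is integrable with $\mathbb E[\mathrm{Gap}(x_K,y_K)]\le\varepsilon$, and the total number of iterations satisfies $$\sum_{k=1}^KT_k\le C\,\frac{(\mu/\mu_x+1)B^2}{\min\{\mu,\mu_y\}\,\varepsilon}\,\log\frac1\varepsilon\qquad\text{if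 }\varepsilon\le\bar\varepsilon,$$ and, for every $\varepsilon>0$, $$\sum_{k=1}^KT_k\le C\Big(1+\frac{(\mu/\mu_x+1)\max\{\varepsilon_0/\eta_0,B^2\}}{\min\{\mu,\mu_y\}\,\varepsilon}\Big)\Big(1+\log\Big(1+\frac{(\mu/\mu_x+1)(\varepsilon_0+\eta_0B^2)}{\varepsilon}\Big)\Big).$$ -/

import Mathlib

open MeasureTheory ProbabilityTheory

noncomputable section

/-- `h` is differentiable with `L`-Lipschitz gradient. -/
def IsSmoothFn {E : Type*} [NormedAddCommGroup E] [InnerProductSpace ℝ E] [CompleteSpace E]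
    (L : ℝ) (h : E → ℝ) : Prop :=
  Differentiable ℝ h ∧ ∀ x x', ‖gradient h x - gradient h x'‖ ≤ L * ‖x - x'‖

/-- A differentiable `h` is `ρ`-weakly convex on the whole space. -/
def IsWeaklyConvexFn {E : Type*} [NormedAddCommGroup E] [InnerProductSpace ℝ E] [CompleteSpace E]
    (ρ : ℝ) (h : E → ℝ) : Prop :=
  Differentiable ℝ h ∧
    ∀ x x', inner ℝ (gradient h x') (x - x') - ρ / 2 * ‖x - x'‖ ^ 2 ≤ h x - h x'

/-- The `μ`-Polyak-Łojasiewicz condition on the whole space: `h` is differentiable, has a global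
minimum, and `‖∇ h x‖² ≥ 2 μ (h x - min h)` for all `x`. -/
def IsPLFn {E : Type*} [NormedAddCommGroup E] [InnerProductSpace ℝ E] [CompleteSpace E]
    (μ : ℝ) (h : E → ℝ) : Prop :=
  Differentiable ℝ h ∧
    ∃ xs, (∀ x, h xs ≤ h x) ∧ ∀ x, 2 * μ * (h x - h xs) ≤ ‖gradient h x‖ ^ 2

/-- The primal objective `P x = max_{y ∈ Y} f x y`. -/
def primalObj {E F : Type*} (f : E → F → ℝ) (Y : Set F) (x : E) : ℝ :=
  ⨆ y : Y, f x y

/-- The duality gap `max_{y' ∈ Y} f x y' - min_{x'} f x' y`. -/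
def dualityGap {E F : Type*} (f : E → F → ℝ) (Y : Set F) (x : E) (y : F) : ℝ :=
  (⨆ y' : Y, f x y') - ⨅ x' : E, f x' y

/-- The assumptions on the deterministic problem `min_x max_{y ∈ Y} f x y`. -/
structure MinMaxAssumptions {E F : Type*}
    [NormedAddCommGroup E] [InnerProductSpace ℝ E] [CompleteSpace E]
    [NormedAddCommGroup F] [InnerProductSpace ℝ F] [CompleteSpace F]
    (f : E → F → ℝ) (Y : Set F) (ell L ρ μ μx μy : ℝ) : Prop where
  closed_Y : IsClosed Y
  convex_Y : Convex ℝ Y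
  diff_x : ∀ x, ∀ y ∈ Y, DifferentiableAt ℝ (fun x' => f x' y) x
  diff_y : ∀ x, ∀ y ∈ Y, DifferentiableAt ℝ (fun y' => f x y') y
  /-- `F = (∇_x f, -∇_y f)` is `ell`-Lipschitz on `E × Y` (Euclidean norms). -/
  lipschitz_grad : ∀ x x', ∀ y ∈ Y, ∀ y' ∈ Y,
    ‖gradient (fun u => f u y) x - gradient (fun u => f u y') x'‖ ^ 2
      + ‖gradient (fun v => f x v) y - gradient (fun v => f x' v) y'‖ ^ 2
      ≤ ell ^ 2 * (‖x - x'‖ ^ 2 + ‖y - y'‖ ^ 2)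
  strongConcave_y : ∀ x, StrongConcaveOn Y μy (f x)
  smooth_primal : IsSmoothFn L (primalObj f Y)
  primal_min : ∃ xs, ∀ x, primalObj f Y xs ≤ primalObj f Y x
  weaklyConvex_x : ∀ y ∈ Y, IsWeaklyConvexFn ρ (fun x => f x y)
  rho_le_ell : ρ ≤ ell
  primal_PL : IsPLFn μ (primalObj f Y)
  x_side_PL : ∀ y ∈ Y, IsPLFn μx (fun x => f x y)

/-- The objective minimized over `E × Y` in the proximal step `Π^γ_{zbar, x₀}(g)`. -/
def proxObj {E F : Type*}
    [NormedAddCommGroup E] [InnerProductSpace ℝ E]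
    [NormedAddCommGroup F] [InnerProductSpace ℝ F]
    (γ : ℝ) (x₀ : E) (zbar g z : E × F) : ℝ :=
  inner ℝ g.1 z.1 + inner ℝ g.2 z.2
    + 1 / 2 * (‖z.1 - zbar.1‖ ^ 2 + ‖z.2 - zbar.2‖ ^ 2)
    + γ / 2 * ‖z.1 - x₀‖ ^ 2

/-- `Π^γ_{zbar, x₀}(g)`: the minimizer of `proxObj` over `E × Y` (it exists and is unique when
`Y` is nonempty, closed and convex in a complete space and `0 ≤ γ`). -/
def proxStep {E F : Type*}
    [NormedAddCommGroup E] [InnerProductSpace ℝ E]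
    [NormedAddCommGroup F] [InnerProductSpace ℝ F]
    (Y : Set F) (γ : ℝ) (x₀ : E) (zbar g : E × F) : E × F :=
  Classical.epsilon fun z : E × F =>
    z.2 ∈ Y ∧ ∀ w : E × F, w.2 ∈ Y → proxObj γ x₀ zbar g z ≤ proxObj γ x₀ zbar g w

/-- The SGDA iterates `z_t` of one epoch with step size `η`, started at (and regularized towards
the `x`-part of) `z₀`; `Gx x y s`, `Gy x y s` are the stochastic partial gradients at the
sample `s`, and the `t`-th sample is `ξ t`. -/
def sgdaIter {E F S : Type*}
    [NormedAddCommGroup E] [InnerProductSpace ℝ E]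
    [NormedAddCommGroup F] [InnerProductSpace ℝ F]
    (Y : Set F) (Gx : E → F → S → E) (Gy : E → F → S → F) (γ η : ℝ) (z₀ : E × F)
    (ξ : ℕ → S) : ℕ → E × F
  | 0 => z₀
  | t + 1 =>
    let z := sgdaIter Y Gx Gy γ η z₀ ξ t
    proxStep Y (γ * η) z₀.1 z (η • Gx z.1 z.2 (ξ t), -(η • Gy z.1 z.2 (ξ t)))

/-- The proximal epoch stochastic method with SGDA updates: `pesIter … k = (x_k, y_k)` is the
average of the `T k` iterates `z_1, …, z_{T k}` of epoch `k`, which has step size `η k`, samples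
`ξ k 0, ξ k 1, …` and starts at `(x_{k-1}, y_{k-1})`. -/
def pesIter {E F S : Type*}
    [NormedAddCommGroup E] [InnerProductSpace ℝ E]
    [NormedAddCommGroup F] [InnerProductSpace ℝ F]
    (Y : Set F) (Gx : E → F → S → E) (Gy : E → F → S → F) (γ : ℝ) (η : ℕ → ℝ) (T : ℕ → ℕ)
    (z₀ : E × F) (ξ : ℕ → ℕ → S) : ℕ → E × F
  | 0 => z₀
  | k + 1 =>
    (T (k + 1) : ℝ)⁻¹ • ∑ t ∈ Finset.Icc 1 (T (k + 1)),
      sgdaIter Y Gx Gy γ (η (k + 1)) (pesIter Y Gx Gy γ η T z₀ ξ k) (ξ (k + 1)) t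

/-- Step size of epoch `k ≥ 1`. -/
def stepSize (η₀ : ℝ) (k : ℕ) : ℝ :=
  η₀ * Real.exp (-(((k : ℝ) - 1) / 16))

/-- Number of inner iterations of epoch `k ≥ 1`. -/
def epochLength (η₀ μ μy : ℝ) (k : ℕ) : ℕ :=
  ⌈768 / (η₀ * min (μ / 8) μy) * Real.exp (((k : ℝ) - 1) / 16)⌉₊

/-- Independent samples and an unbiased stochastic gradient oracle for `f` on `E × Y`. -/
structure IsUnbiasedOracle {E F S Ω : Type*}
    [NormedAddCommGroup E] [InnerProductSpace ℝ E] [CompleteSpace E] [MeasurableSpace E]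
    [NormedAddCommGroup F] [InnerProductSpace ℝ F] [CompleteSpace F] [MeasurableSpace F]
    [MeasurableSpace S] [MeasurableSpace Ω]
    (Pr : Measure Ω) (f : E → F → ℝ) (Y : Set F) (Gx : E → F → S → E) (Gy : E → F → S → F)
    (ξ : ℕ → ℕ → Ω → S) : Prop where
  measurable_Gx : Measurable fun p : E × F × S => Gx p.1 p.2.1 p.2.2
  measurable_Gy : Measurable fun p : E × F × S => Gy p.1 p.2.1 p.2.2
  measurable_sample : ∀ k t, Measurable (ξ k t)
  indep : iIndepFun (fun p : ℕ × ℕ => ξ p.1 p.2) Pr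
  integrable_x : ∀ k t x, ∀ y ∈ Y, Integrable (fun ω => Gx x y (ξ k t ω)) Pr
  integrable_y : ∀ k t x, ∀ y ∈ Y, Integrable (fun ω => Gy x y (ξ k t ω)) Pr
  unbiased_x : ∀ k t x, ∀ y ∈ Y, ∫ ω, Gx x y (ξ k t ω) ∂Pr = gradient (fun u => f u y) x
  unbiased_y : ∀ k t x, ∀ y ∈ Y, ∫ ω, Gy x y (ξ k t ω) ∂Pr = gradient (fun v => f x v) y

/-- The second moments of the stochastic partial gradients are at most `B ^ 2` at all points
`z_0, …, z_{T k}` visited in any epoch `k ≥ 1` of the method. (This holds in particular if the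
stochastic gradients are bounded by `B` everywhere.) -/
def BoundedGradientsAlongRun {E F S Ω : Type*}
    [NormedAddCommGroup E] [InnerProductSpace ℝ E]
    [NormedAddCommGroup F] [InnerProductSpace ℝ F] [MeasurableSpace Ω]
    (Pr : Measure Ω) (B : ℝ) (Y : Set F) (Gx : E → F → S → E) (Gy : E → F → S → F) (γ : ℝ)
    (η : ℕ → ℝ) (T : ℕ → ℕ) (z₀ : E × F) (ξ : ℕ → ℕ → Ω → S) : Prop :=
  ∀ k t : ℕ, t ≤ T (k + 1) →
    let z : Ω → E × F := fun ω =>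
      sgdaIter Y Gx Gy γ (η (k + 1)) (pesIter Y Gx Gy γ η T z₀ (fun i j => ξ i j ω) k)
        (fun j => ξ (k + 1) j ω) t
    ∫⁻ ω, ENNReal.ofReal (‖Gx (z ω).1 (z ω).2 (ξ (k + 1) t ω)‖ ^ 2) ∂Pr ≤ ENNReal.ofReal (B ^ 2) ∧
    ∫⁻ ω, ENNReal.ofReal (‖Gy (z ω).1 (z ω).2 (ξ (k + 1) t ω)‖ ^ 2) ∂Pr ≤ ENNReal.ofReal (B ^ 2)

end

/-! Write P for the primal objective, P* for its minimum, γ = μ/4, and `regGap` for the duality gap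
after adding γ/2‖x - c‖² to f. As ρ ≤ μ/8 = γ/2, the regularized problem is γ/2-strongly convex in
x, besides being μy-strongly concave in y. Let an epoch go from (c, y₀) to the average (x₁, y₁); let
H be the regularized gap at its start and G the one at its end, both with centre c.

Inner loop. The regret of SGDA against the best responses to (x₁, y₁) bounds ηT·G by 5/4 of their
squared distance to the start, plus noise. Quadratic growth bounds this distance by a multiple of H
+ G, so for ηT large enough G ≤ H/300 + noise (`sgda_regGap_le`). The best responses depend on the
samples, so the gradient errors paired with them need not have mean zero. Young's inequality
separates the comparator from the summed error, which is a martingale with second moment O(B²T); the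
rest is a martingale transform with mean zero. After division by ηT, the expected noise is O(ηB²).

Outer loop. Up to G, the point x₁ is the proximal point of P at c, so the PL condition of P
contracts P - P* (`primal_decrease`). Moving the centre to x₁ costs a multiple of G + P(c) - P*
(`regGap_recenter`). Hence the potential (P - P*) + H/40 shrinks by 14/15 per epoch, up to noise
(`epoch_decrease`). The step size shrinks by e^(-1/16) > 14/15, so the expected potential decays
like the step size. The PL condition in x turns regularized gaps into the original one at the price
of a factor of order μ/μx + 1 (`dualityGap_le`).

Counting. Accuracy ε needs K ≈ 16 log(const·(μ/μx + 1)(ε₀ + η₀B²)/ε) epochs. Their lengths grow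
geometrically, so the total is of order e^(K/16)/(η₀ min(μ/8, μy)), plus at most K from rounding up.
-/

open Filter Topology

/-! ### Strong concavity, weak convexity and proximal points -/

section Convexity

variable {E : Type*} [NormedAddCommGroup E] [InnerProductSpace ℝ E]

/-- Quadratic growth of a strongly concave function away from its maximizer. -/
theorem StrongConcaveOn.growth_of_max {s : Set E} {m : ℝ} {f : E → ℝ} (hf : StrongConcaveOn s m f)
    {ys y : E} (hs : ys ∈ s) (hmax : ∀ u ∈ s, f u ≤ f ys) (hy : y ∈ s) :
    f y + m / 2 * ‖y - ys‖ ^ 2 ≤ f ys := by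
  -- Strong concavity at (1 - t)ys + ty, where f is at most f ys; divide by t and let t → 0.
  have hl2 : Tendsto (fun t : ℝ => f y + (1 - t) * (m / 2 * ‖y - ys‖ ^ 2)) (𝓝[>] 0)
      (𝓝 (f y + (1 - 0) * (m / 2 * ‖y - ys‖ ^ 2))) := by
    apply Tendsto.mono_left _ nhdsWithin_le_nhds
    exact Continuous.tendsto (by fun_prop) 0
  have := le_of_tendsto hl2 (b := f ys) (by
    filter_upwards [Ioo_mem_nhdsGT (zero_lt_one (α := ℝ))] with t ht
    have h := hf.2 hs hy (sub_nonneg.2 ht.2.le) ht.1.le (by ring)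
    have h2 := hmax _ (hf.1 hs hy (sub_nonneg.2 ht.2.le) ht.1.le (by ring))
    rw [norm_sub_rev] at h
    simp only [smul_eq_mul] at h
    have h3 := h.trans h2
    have ht0 := ht.1
    have : t * (f y + (1 - t) * (m / 2 * ‖y - ys‖ ^ 2)) ≤ t * f ys := by linarith
    exact le_of_mul_le_mul_left this ht0)
  linarith

variable [CompleteSpace E]

/-- If `φ - ψ` is minimal at `x`, then `φ` and `ψ` have the same gradient there. -/
theorem HasGradientAt.eq_of_sub_min {φ ψ : E → ℝ} {g g' x : E} (hφ : HasGradientAt φ g x)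
    (hψ : HasGradientAt ψ g' x) (hmin : ∀ u, φ x - ψ x ≤ φ u - ψ u) : g = g' := by
  have h := hφ.hasFDerivAt.sub hψ.hasFDerivAt
  have h0 := IsLocalMin.hasFDerivAt_eq_zero (Filter.Eventually.of_forall hmin) h
  exact (InnerProductSpace.toDual ℝ E).injective (sub_eq_zero.1 h0)

theorem hasGradientAt_half_mul_norm_sub_sq (a : ℝ) (c x : E) :
    HasGradientAt (fun u => a / 2 * ‖u - c‖ ^ 2) (a • (x - c)) x := by
  rw [hasGradientAt_iff_hasFDerivAt]
  have h := (((hasFDerivAt_id (𝕜 := ℝ) x).sub_const c).norm_sq).const_mul (a / 2)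
  refine h.congr_fderiv ?_
  ext u
  simp
  ring

/-- First-order upper bound for strongly concave functions. -/
theorem StrongConcaveOn.le_gradient {s : Set E} {m : ℝ} {f : E → ℝ} (hf : StrongConcaveOn s m f)
    {y₀ y : E} (hd : DifferentiableAt ℝ f y₀) (h₀ : y₀ ∈ s) (hy : y ∈ s) :
    f y ≤ f y₀ + inner ℝ (gradient f y₀) (y - y₀) - m / 2 * ‖y - y₀‖ ^ 2 := by
  have hl : HasDerivAt (fun t : ℝ => y₀ + t • (y - y₀)) (y - y₀) 0 := by
    simpa using ((hasDerivAt_id (0 : ℝ)).smul_const (y - y₀)).const_add y₀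
  have hg : HasFDerivAt f ((InnerProductSpace.toDual ℝ E) (gradient f y₀))
      ((fun t : ℝ => y₀ + t • (y - y₀)) 0) := by
    simpa using hd.hasGradientAt.hasFDerivAt
  have hd1 : HasDerivAt (fun t : ℝ => f (y₀ + t • (y - y₀)))
      (inner ℝ (gradient f y₀) (y - y₀)) 0 := by
    have h := hg.comp_hasDerivAt (0 : ℝ) hl
    rwa [InnerProductSpace.toDual_apply_apply] at h
  have hs := hd1.tendsto_slope_zero_right
  have hl2 : Tendsto (fun t : ℝ => f y - f y₀ + (1 - t) * (m / 2 * ‖y - y₀‖ ^ 2)) (𝓝[>] 0)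
      (𝓝 (f y - f y₀ + (1 - 0) * (m / 2 * ‖y - y₀‖ ^ 2))) := by
    apply Tendsto.mono_left _ nhdsWithin_le_nhds
    exact Continuous.tendsto (by fun_prop) 0
  have := le_of_tendsto_of_tendsto hl2 hs (by
    filter_upwards [Ioo_mem_nhdsGT (zero_lt_one (α := ℝ))] with t ht
    have h := hf.2 h₀ hy (sub_nonneg.2 ht.2.le) ht.1.le (by ring)
    have e : (1 - t) • y₀ + t • y = y₀ + t • (y - y₀) := by module
    rw [e, norm_sub_rev] at h
    simp only [smul_eq_mul, zero_add, zero_smul, add_zero] at h ⊢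
    rw [← sub_nonneg]
    have ht0 := ht.1
    have : t⁻¹ * (f (y₀ + t • (y - y₀)) - f y₀) - (f y - f y₀ + (1 - t) * (m / 2 * ‖y - y₀‖ ^ 2))
      = t⁻¹ * (f (y₀ + t • (y - y₀)) - ((1 - t) * f y₀ + t * f y
          + (1 - t) * t * (m / 2 * ‖y - y₀‖ ^ 2))) := by
      field_simp; ring
    rw [this]
    exact mul_nonneg (inv_nonneg.2 ht0.le) (sub_nonneg.2 h))
  linarith

/-- A strongly concave differentiable function attains its maximum on a closed set. -/
theorem StrongConcaveOn.exists_max [ProperSpace E] {s : Set E} {m : ℝ} {f : E → ℝ} (hm : 0 < m)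
    (hs : IsClosed s) (hne : s.Nonempty) (hf : StrongConcaveOn s m f)
    (hd : ∀ y ∈ s, DifferentiableAt ℝ f y) : ∃ ys ∈ s, ∀ y ∈ s, f y ≤ f ys := by
  obtain ⟨y₀, h₀⟩ := hne
  have hc : ContinuousOn (fun y => - f y) s := fun y hy =>
    (hd y hy).continuousAt.continuousWithinAt.neg
  obtain ⟨ys, hys, hmin⟩ := hc.exists_isMinOn' hs h₀ (by
    rw [eventually_inf_principal]
    filter_upwards [(isCompact_closedBall y₀ (2 * ‖gradient f y₀‖ / m)).compl_mem_cocompact]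
      with y hy1 hy2
    simp only [Set.mem_compl_iff, Metric.mem_closedBall, not_le, dist_eq_norm] at hy1
    have h := hf.le_gradient (hd y₀ h₀) h₀ hy2
    have h2 := real_inner_le_norm (gradient f y₀) (y - y₀)
    rw [div_lt_iff₀ hm] at hy1
    have h3 : ‖gradient f y₀‖ * ‖y - y₀‖ ≤ m / 2 * ‖y - y₀‖ ^ 2 := by
      nlinarith [norm_nonneg (y - y₀)]
    simp only [neg_le_neg_iff]
    linarith)
  exact ⟨ys, hys, fun y hy => neg_le_neg_iff.1 (hmin hy)⟩

/-- The proximal point of a weakly convex function: its optimality condition and the quadratic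
growth of the regularized function. -/
theorem IsWeaklyConvexFn.exists_prox [ProperSpace E] {ρ γ : ℝ} {φ : E → ℝ}
    (hφ : IsWeaklyConvexFn ρ φ) (hγ : 0 < γ) {xs : E} (hxs : ∀ x, φ xs ≤ φ x) (c : E) :
    ∃ xh, gradient φ xh = γ • (c - xh) ∧
      ∀ x, φ xh + γ / 2 * ‖xh - c‖ ^ 2 + (γ - ρ) / 2 * ‖x - xh‖ ^ 2 ≤ φ x + γ / 2 * ‖x - c‖ ^ 2 := by
  have hcont : Continuous fun x => φ x + γ / 2 * ‖x - c‖ ^ 2 := by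
    have := hφ.1.continuous
    fun_prop
  -- Coercivity: φ is bounded below by φ xs, so the quadratic wins far away. The 1 in the radius
  -- avoids a square root: ‖x - c‖ > 1 + a with a ≥ 0 gives ‖x - c‖² ≥ a.
  obtain ⟨xh, hmin⟩ := hcont.exists_forall_le' c (by
    filter_upwards [(isCompact_closedBall c (1 + (φ c - φ xs) * (2 / γ))).compl_mem_cocompact]
      with x hx
    simp only [Set.mem_compl_iff, Metric.mem_closedBall, not_le, dist_eq_norm] at hx
    have h0 : 0 ≤ (φ c - φ xs) * (2 / γ) := mul_nonneg (sub_nonneg.2 (hxs c)) (by positivity)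
    have h1 : (φ c - φ xs) * (2 / γ) ≤ ‖x - c‖ ^ 2 := by nlinarith
    have h2 : φ c - φ xs ≤ γ / 2 * ‖x - c‖ ^ 2 := by
      calc φ c - φ xs = γ / 2 * ((φ c - φ xs) * (2 / γ)) := by field_simp
        _ ≤ _ := by gcongr
    have := hxs x
    simp
    linarith)
  have hgrad : gradient φ xh = γ • (c - xh) := by
    have h1 := (hφ.1 xh).hasGradientAt
    have h2 := hasGradientAt_half_mul_norm_sub_sq (-γ) c xh
    rw [h1.eq_of_sub_min h2 (fun u => by have := hmin u; linarith)]
    module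
  refine ⟨xh, hgrad, fun x => ?_⟩
  have h := hφ.2 x xh
  rw [hgrad] at h
  have e : ‖x - c‖ ^ 2 = ‖x - xh‖ ^ 2 + 2 * inner ℝ (x - xh) (xh - c) + ‖xh - c‖ ^ 2 := by
    rw [← norm_add_sq_real]; congr 2; abel
  have e2 : inner ℝ (γ • (c - xh)) (x - xh) = - γ * inner ℝ (x - xh) (xh - c) := by
    rw [← neg_sub xh c, smul_neg, inner_neg_left, real_inner_smul_left, real_inner_comm]; ring
  rw [e2] at h
  rw [e]
  linarith

/-- Jensen's inequality for the regularization of a weakly convex function. -/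
theorem IsWeaklyConvexFn.map_average_le {ρ γ : ℝ} {φ : E → ℝ} (hφ : IsWeaklyConvexFn ρ φ)
    (hργ : ρ ≤ γ) (c : E) {ι : Type*} (s : Finset ι) (hs : s.Nonempty) (x : ι → E) :
    (s.card : ℝ) * (φ ((s.card : ℝ)⁻¹ • ∑ i ∈ s, x i)
        + γ / 2 * ‖(s.card : ℝ)⁻¹ • ∑ i ∈ s, x i - c‖ ^ 2)
      ≤ ∑ i ∈ s, (φ (x i) + γ / 2 * ‖x i - c‖ ^ 2) := by
  set m := (s.card : ℝ)⁻¹ • ∑ i ∈ s, x i with hm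
  have hcard : (s.card : ℝ) ≠ 0 := by exact_mod_cast hs.card_ne_zero
  have hsum : ∑ i ∈ s, (x i - m) = 0 := by
    rw [Finset.sum_sub_distrib, Finset.sum_const, hm, ← Nat.cast_smul_eq_nsmul ℝ, smul_smul,
      mul_inv_cancel₀ hcard, one_smul, sub_self]
  have key : ∀ i ∈ s, φ m + γ / 2 * ‖m - c‖ ^ 2
      + inner ℝ (gradient φ m + γ • (m - c)) (x i - m) ≤ φ (x i) + γ / 2 * ‖x i - c‖ ^ 2 := by
    intro i _
    have h := hφ.2 (x i) m
    have e : ‖x i - c‖ ^ 2 = ‖x i - m‖ ^ 2 + 2 * inner ℝ (m - c) (x i - m) + ‖m - c‖ ^ 2 := by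
      rw [real_inner_comm, ← norm_add_sq_real]; congr 2; abel
    rw [inner_add_left, real_inner_smul_left, e]
    have : 0 ≤ (γ - ρ) / 2 * ‖x i - m‖ ^ 2 := by
      have := sub_nonneg.2 hργ; positivity
    linarith
  have h := Finset.sum_le_sum key
  rw [Finset.sum_add_distrib, ← inner_sum, hsum, inner_zero_right, add_zero, Finset.sum_const,
    nsmul_eq_mul] at h
  exact h

end Convexity

/-! ### Deterministic estimates for the regularized duality gap -/

/-- The duality gap of the problem regularized by `γ / 2 * ‖x - c‖ ^ 2`. -/
noncomputable def regGap {E F : Type*} [NormedAddCommGroup E] (f : E → F → ℝ) (Y : Set F) (γ : ℝ)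
    (c x : E) (y : F) : ℝ :=
  primalObj f Y x + γ / 2 * ‖x - c‖ ^ 2 - ⨅ x' : E, (f x' y + γ / 2 * ‖x' - c‖ ^ 2)

namespace MinMaxAssumptions

variable {E F : Type*} [NormedAddCommGroup E] [InnerProductSpace ℝ E] [CompleteSpace E]
  [NormedAddCommGroup F] [InnerProductSpace ℝ F] [CompleteSpace F]
  {f : E → F → ℝ} {Y : Set F} {ell L ρ μ μx μy γ : ℝ}

theorem bddBelow_x (h : MinMaxAssumptions f Y ell L ρ μ μx μy) {y : F} (hy : y ∈ Y) :
    BddBelow (Set.range fun x => f x y) := by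
  obtain ⟨-, xs, hxs, -⟩ := h.x_side_PL y hy
  exact ⟨f xs y, by rintro _ ⟨x, rfl⟩; exact hxs x⟩

/-- At the centre the penalty vanishes in the primal term and can only raise the minimum over x'.
This bounds the initial potential by ε₀. -/
theorem regGap_le_dualityGap (h : MinMaxAssumptions f Y ell L ρ μ μx μy) (hγ : 0 < γ) {y : F}
    (hy : y ∈ Y) (c : E) : regGap f Y γ c c y ≤ dualityGap f Y c y := by
  have h1 : (⨅ x', f x' y) ≤ ⨅ x' : E, (f x' y + γ / 2 * ‖x' - c‖ ^ 2) :=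
    ciInf_mono (h.bddBelow_x hy) fun x' => by
      have : 0 ≤ γ / 2 * ‖x' - c‖ ^ 2 := by positivity
      linarith
  have e1 : dualityGap f Y c y = primalObj f Y c - ⨅ x', f x' y := rfl
  rw [e1, regGap, sub_self, norm_zero]
  linarith

section

variable [ProperSpace F]

/-- Strong concavity makes the maximum attained even on an unbounded Y, so the supremum in
`primalObj` is genuine and not a default value. -/
theorem exists_argmax (h : MinMaxAssumptions f Y ell L ρ μ μx μy) (hμy : 0 < μy)
    (hne : Y.Nonempty) (x : E) :
    ∃ ys ∈ Y, primalObj f Y x = f x ys ∧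
      ∀ y ∈ Y, f x y + μy / 2 * ‖y - ys‖ ^ 2 ≤ primalObj f Y x := by
  obtain ⟨ys, hys, hmax⟩ := (h.strongConcave_y x).exists_max hμy h.closed_Y hne (h.diff_y x)
  have : Nonempty Y := hne.to_subtype
  have e : primalObj f Y x = f x ys :=
    le_antisymm (ciSup_le fun y => hmax y y.2)
      (le_ciSup (f := fun y : Y => f x y) ⟨f x ys, by rintro _ ⟨y, rfl⟩; exact hmax y y.2⟩ ⟨ys, hys⟩)
  exact ⟨ys, hys, e, fun y hy => e ▸ (h.strongConcave_y x).growth_of_max hys hmax hy⟩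

theorem le_primalObj (h : MinMaxAssumptions f Y ell L ρ μ μx μy) (hμy : 0 < μy) (x : E) {y : F}
    (hy : y ∈ Y) : f x y ≤ primalObj f Y x := by
  obtain ⟨ys, -, -, hmax⟩ := h.exists_argmax hμy ⟨y, hy⟩ x
  have := hmax y hy
  have : 0 ≤ μy / 2 * ‖y - ys‖ ^ 2 := by positivity
  linarith

/-- An envelope argument: with ys a maximizer at x', the function f(·, ys) lies below P and touches
it at x', so the gradients agree there and the weak convexity inequality of f(·, ys) passes to P. -/
theorem weaklyConvex_primalObj (h : MinMaxAssumptions f Y ell L ρ μ μx μy) (hμy : 0 < μy)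
    (hne : Y.Nonempty) : IsWeaklyConvexFn ρ (primalObj f Y) := by
  refine ⟨h.smooth_primal.1, fun x x' => ?_⟩
  obtain ⟨ys, hys, e, -⟩ := h.exists_argmax hμy hne x'
  have hg : gradient (primalObj f Y) x' = gradient (fun u => f u ys) x' :=
    (h.smooth_primal.1 x').hasGradientAt.eq_of_sub_min (h.diff_x x' ys hys).hasGradientAt
      (fun u => by rw [e, sub_self]; exact sub_nonneg.2 (h.le_primalObj hμy u hys))
  have h1 := (h.weaklyConvex_x ys hys).2 x x'
  have h2 := h.le_primalObj hμy x hys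
  rw [hg, e]
  linarith

theorem dualityGap_nonneg (h : MinMaxAssumptions f Y ell L ρ μ μx μy) (hμy : 0 < μy) {y : F}
    (hy : y ∈ Y) (x : E) : 0 ≤ dualityGap f Y x y := by
  have h1 := ciInf_le (h.bddBelow_x hy) x
  have h2 := h.le_primalObj hμy x hy
  have e1 : dualityGap f Y x y = primalObj f Y x - ⨅ x', f x' y := rfl
  linarith

theorem primal_sub_le_dualityGap (h : MinMaxAssumptions f Y ell L ρ μ μx μy) (hμy : 0 < μy)
    {y : F} (hy : y ∈ Y) (x xs : E) :
    primalObj f Y x - primalObj f Y xs ≤ dualityGap f Y x y := by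
  have h1 := ciInf_le (h.bddBelow_x hy) xs
  have h2 := h.le_primalObj hμy xs hy
  have e1 : dualityGap f Y x y = primalObj f Y x - ⨅ x', f x' y := rfl
  linarith

end

section

variable [ProperSpace E]

/-- As 2ρ ≤ γ, the growth constant (γ - ρ)/2 is at least γ/4, which no longer involves ρ. -/
theorem exists_prox (h : MinMaxAssumptions f Y ell L ρ μ μx μy) (hγ : 0 < γ) (hργ : 2 * ρ ≤ γ)
    {y : F} (hy : y ∈ Y) (c : E) :
    ∃ xh, gradient (fun x => f x y) xh = γ • (c - xh) ∧
      (⨅ x' : E, (f x' y + γ / 2 * ‖x' - c‖ ^ 2)) = f xh y + γ / 2 * ‖xh - c‖ ^ 2 ∧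
      ∀ x, (⨅ x' : E, (f x' y + γ / 2 * ‖x' - c‖ ^ 2)) + γ / 4 * ‖x - xh‖ ^ 2
        ≤ f x y + γ / 2 * ‖x - c‖ ^ 2 := by
  obtain ⟨-, xs, hxs, -⟩ := h.x_side_PL y hy
  obtain ⟨xh, hg, hmin⟩ := (h.weaklyConvex_x y hy).exists_prox hγ hxs c
  have hgrow : ∀ x, f xh y + γ / 2 * ‖xh - c‖ ^ 2 + γ / 4 * ‖x - xh‖ ^ 2
      ≤ f x y + γ / 2 * ‖x - c‖ ^ 2 := fun x => by
    have := hmin x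
    have : 0 ≤ (γ - 2 * ρ) / 4 * ‖x - xh‖ ^ 2 := by
      have := sub_nonneg.2 hργ; positivity
    linarith
  have hle : ∀ x, f xh y + γ / 2 * ‖xh - c‖ ^ 2 ≤ f x y + γ / 2 * ‖x - c‖ ^ 2 := fun x => by
    have := hgrow x
    have : 0 ≤ γ / 4 * ‖x - xh‖ ^ 2 := by positivity
    linarith
  have e : (⨅ x' : E, (f x' y + γ / 2 * ‖x' - c‖ ^ 2)) = f xh y + γ / 2 * ‖xh - c‖ ^ 2 :=
    le_antisymm (ciInf_le (f := fun x' => f x' y + γ / 2 * ‖x' - c‖ ^ 2)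
      ⟨_, by rintro _ ⟨x, rfl⟩; exact hle x⟩ xh) (le_ciInf hle)
  exact ⟨xh, hg, e, fun x => e ▸ hgrow x⟩

theorem iInf_reg_le (h : MinMaxAssumptions f Y ell L ρ μ μx μy) (hγ : 0 < γ) (hργ : 2 * ρ ≤ γ)
    {y : F} (hy : y ∈ Y) (c x : E) :
    (⨅ x' : E, (f x' y + γ / 2 * ‖x' - c‖ ^ 2)) ≤ f x y + γ / 2 * ‖x - c‖ ^ 2 := by
  obtain ⟨xh, -, -, hgrow⟩ := h.exists_prox hγ hργ hy c
  have := hgrow x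
  have : 0 ≤ γ / 4 * ‖x - xh‖ ^ 2 := by positivity
  linarith

end

variable [ProperSpace E] [ProperSpace F]

theorem regGap_nonneg (h : MinMaxAssumptions f Y ell L ρ μ μx μy) (hμy : 0 < μy) (hγ : 0 < γ)
    (hργ : 2 * ρ ≤ γ) {y : F} (hy : y ∈ Y) (c x : E) : 0 ≤ regGap f Y γ c x y := by
  have h1 := h.iInf_reg_le hγ hργ hy c x
  have h2 := h.le_primalObj hμy x hy
  unfold regGap
  linarith

/-- The regularized gap at `(x₁, y₁)` is attained at a pair of best responses, which are close to
the starting point `(c, y₀)` if the regularized gaps at both points are small. -/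
theorem exists_best_responses (h : MinMaxAssumptions f Y ell L ρ μ μx μy) (hμy : 0 < μy)
    (hγ : 0 < γ) (hργ : 2 * ρ ≤ γ) {y₀ y₁ : F} (h₀ : y₀ ∈ Y) (h₁ : y₁ ∈ Y) (c x₁ : E) :
    ∃ xh, ∃ yh ∈ Y, regGap f Y γ c x₁ y₁
        = f x₁ yh + γ / 2 * ‖x₁ - c‖ ^ 2 - (f xh y₁ + γ / 2 * ‖xh - c‖ ^ 2) ∧
      γ / 4 * ‖xh - c‖ ^ 2 + μy / 2 * ‖yh - y₀‖ ^ 2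
        ≤ regGap f Y γ c c y₀ + regGap f Y γ c x₁ y₁ := by
  obtain ⟨xh, -, e, hgrow⟩ := h.exists_prox hγ hργ h₁ c
  obtain ⟨yh, hyh, e', hgrow'⟩ := h.exists_argmax hμy ⟨_, h₀⟩ x₁
  refine ⟨xh, yh, hyh, by rw [regGap, e, e'], ?_⟩
  -- Growth around each best response is tested at the starting point. The cross terms f(c, y₁) and
  -- f(x₁, y₀) are then bounded by P(c) and by the regularized minimum at y₀, which leaves the sum
  -- of the two gaps.
  have i1 := hgrow c
  have i2 := hgrow' y₀ h₀
  have i3 := h.iInf_reg_le hγ hργ h₀ c x₁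
  have i4 := h.le_primalObj hμy c h₁
  rw [norm_sub_rev c xh, sub_self, norm_zero] at i1
  rw [norm_sub_rev] at i2
  simp only [regGap, sub_self, norm_zero]
  linarith

/-- The proximal point of the primal objective. -/
theorem exists_primal_prox (h : MinMaxAssumptions f Y ell L ρ (4 * γ) μx μy) (hμy : 0 < μy)
    (hγ : 0 < γ) (hργ : 2 * ρ ≤ γ) {xs : E} (hxs : ∀ x, primalObj f Y xs ≤ primalObj f Y x)
    {y₁ : F} (h₁ : y₁ ∈ Y) (c x₁ : E) :
    ∃ xp, γ * ‖x₁ - xp‖ ^ 2 ≤ 4 * regGap f Y γ c x₁ y₁ ∧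
      primalObj f Y xp - primalObj f Y xs ≤ γ / 8 * ‖xp - c‖ ^ 2 ∧
      primalObj f Y xp + γ / 2 * ‖xp - c‖ ^ 2 ≤ primalObj f Y c ∧
      primalObj f Y x₁ + γ / 2 * ‖x₁ - c‖ ^ 2
        ≤ primalObj f Y xp + γ / 2 * ‖xp - c‖ ^ 2 + regGap f Y γ c x₁ y₁ := by
  obtain ⟨xp, hg, hmin⟩ := (h.weaklyConvex_primalObj hμy ⟨_, h₁⟩).exists_prox hγ hxs c
  have i1 := h.iInf_reg_le hγ hργ h₁ c xp
  have i2 := h.le_primalObj hμy xp h₁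
  have i3 := hmin x₁
  have i4 : 0 ≤ (γ - 2 * ρ) / 4 * ‖x₁ - xp‖ ^ 2 := by
    have := sub_nonneg.2 hργ; positivity
  refine ⟨xp, ?_, ?_, ?_, ?_⟩
  · unfold regGap; linarith
  -- PL with constant 4γ at the proximal point, where ‖∇P(xp)‖ = γ‖xp - c‖: this gives 8γ(P(xp) -
  -- P*) ≤ γ²‖xp - c‖².
  · obtain ⟨-, xs', hxs', hPL⟩ := h.primal_PL
    have e := le_antisymm (hxs xs') (hxs' xs)
    have i5 := hPL xp
    rw [← e, hg, norm_smul, mul_pow, Real.norm_eq_abs, sq_abs, norm_sub_rev] at i5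
    have : γ * (8 * (primalObj f Y xp - primalObj f Y xs)) ≤ γ * (γ * ‖xp - c‖ ^ 2) := by linarith
    have := le_of_mul_le_mul_left this hγ
    linarith
  · have i5 := hmin c
    have i6 : 0 ≤ (γ - ρ) / 2 * ‖c - xp‖ ^ 2 := by
      have : 0 ≤ γ - ρ := by linarith
      positivity
    rw [sub_self, norm_zero] at i5
    linarith
  · unfold regGap; linarith

/-- The primal suboptimality contracts up to the regularized gap. -/
theorem primal_decrease (h : MinMaxAssumptions f Y ell L ρ (4 * γ) μx μy) (hμy : 0 < μy)
    (hγ : 0 < γ) (hργ : 2 * ρ ≤ γ) {xs : E} (hxs : ∀ x, primalObj f Y xs ≤ primalObj f Y x)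
    {y₁ : F} (h₁ : y₁ ∈ Y) (c x₁ : E) :
    primalObj f Y x₁ - primalObj f Y xs
      ≤ 13 / 25 * (primalObj f Y c - primalObj f Y xs) + 6 * regGap f Y γ c x₁ y₁ := by
  obtain ⟨xp, i1, i2, i3, i4⟩ := h.exists_primal_prox hμy hγ hργ hxs h₁ c x₁
  have e : ‖x₁ - c‖ ^ 2 = ‖x₁ - xp‖ ^ 2 + 2 * inner ℝ (x₁ - xp) (xp - c) + ‖xp - c‖ ^ 2 := by
    rw [← norm_add_sq_real]; congr 2; abel
  -- Young's inequality with weights that leave P(xp) + γ/5·‖xp - c‖². Under P(xp) - P* ≤ γ/8·‖xp -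
  -- c‖² and P(xp) + γ/2·‖xp - c‖² ≤ P(c) the worst case has equality in both, with ratio (1/8 +
  -- 1/5)/(1/8 + 1/2) = 13/25.
  have i5 : 0 ≤ ‖(5 : ℝ) • (x₁ - xp) + (2 : ℝ) • (xp - c)‖ ^ 2 := by positivity
  rw [norm_add_sq_real, norm_smul, norm_smul, real_inner_smul_left, real_inner_smul_right,
    Real.norm_eq_abs, Real.norm_eq_abs, abs_of_pos, abs_of_pos] at i5 <;> try norm_num
  have i6 : 0 ≤ γ / 20 * ((5 * ‖x₁ - xp‖) ^ 2 + 2 * (5 * (2 * inner ℝ (x₁ - xp) (xp - c)))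
      + (2 * ‖xp - c‖) ^ 2) := by positivity
  rw [e] at i4
  nlinarith

/-- Moving the centre of the regularization to the current point. -/
theorem regGap_recenter (h : MinMaxAssumptions f Y ell L ρ (4 * γ) μx μy) (hμy : 0 < μy)
    (hγ : 0 < γ) (hργ : 2 * ρ ≤ γ) {xs : E} (hxs : ∀ x, primalObj f Y xs ≤ primalObj f Y x)
    {y₁ : F} (h₁ : y₁ ∈ Y) (c x₁ : E) :
    regGap f Y γ x₁ x₁ y₁
      ≤ 34 * regGap f Y γ c x₁ y₁ + 16 * (primalObj f Y c - primalObj f Y xs) := by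
  obtain ⟨xp, i1, i2, i3, -⟩ := h.exists_primal_prox hμy hγ hργ hxs h₁ c x₁
  obtain ⟨xh, -, e, hgrow⟩ := h.exists_prox hγ hργ h₁ x₁
  have i4 := hgrow x₁
  have i5 := h.iInf_reg_le hγ hργ h₁ c xh
  have i6 := h.le_primalObj hμy x₁ h₁
  have e1 : ‖xh - c‖ ^ 2 = ‖xh - x₁‖ ^ 2 + 2 * inner ℝ (xh - x₁) (x₁ - c) + ‖x₁ - c‖ ^ 2 := by
    rw [← norm_add_sq_real]; congr 2; abel
  -- The new gap is at most the old one plus γ⟨xh - x₁, x₁ - c⟩. The weight 4 leaves γ/8·‖xh - x₁‖²,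
  -- which growth bounds by half of the new gap, so it can be absorbed on the left.
  have i7 : 0 ≤ γ / 8 * ‖(xh - x₁) - (4 : ℝ) • (x₁ - c)‖ ^ 2 := by positivity
  rw [norm_sub_sq_real, norm_smul, real_inner_smul_right, Real.norm_eq_abs, abs_of_pos] at i7 <;>
    try norm_num
  have e2 : ‖x₁ - c‖ ^ 2 = ‖x₁ - xp‖ ^ 2 + 2 * inner ℝ (x₁ - xp) (xp - c) + ‖xp - c‖ ^ 2 := by
    rw [← norm_add_sq_real]; congr 2; abel
  have i8 : 0 ≤ γ * ‖(x₁ - xp) - (xp - c)‖ ^ 2 := by positivity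
  rw [norm_sub_sq_real] at i8
  have i9 := hxs xp
  rw [sub_self, norm_zero, norm_sub_rev x₁ xh] at i4
  rw [e1] at i5
  have i10 : γ * ‖x₁ - c‖ ^ 2 ≤ 2 * (γ * ‖x₁ - xp‖ ^ 2) + 2 * (γ * ‖xp - c‖ ^ 2) := by
    rw [e2]; linarith
  unfold regGap at i1 ⊢
  rw [e] at i4 ⊢
  simp only [sub_self, norm_zero] at i4 ⊢
  nlinarith

/-- The duality gap of the original problem in terms of regularized gaps. -/
theorem dualityGap_le (h : MinMaxAssumptions f Y ell L ρ μ μx μy) (hμy : 0 < μy) (hμx : 0 < μx)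
    (hγ : 0 < γ) (hργ : 2 * ρ ≤ γ) {y₀ y₁ : F} (h₀ : y₀ ∈ Y) (h₁ : y₁ ∈ Y) (c x₁ : E) :
    dualityGap f Y x₁ y₁ ≤ regGap f Y γ c x₁ y₁
      + 2 * (1 + γ / μx) * (regGap f Y γ c c y₀ + regGap f Y γ c x₁ y₁) := by
  obtain ⟨xh, hg, e, hgrow⟩ := h.exists_prox hγ hργ h₁ c
  obtain ⟨-, xm, hxm, hPL⟩ := h.x_side_PL y₁ h₁
  have i1 := hPL xh
  have i0 : f xm y₁ ≤ ⨅ x', f x' y₁ := le_ciInf hxm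
  have i2 := h.iInf_reg_le hγ hργ h₀ c x₁
  have i3 := h.le_primalObj hμy x₁ h₀
  have i4 := h.le_primalObj hμy c h₁
  have i5 := hgrow c
  rw [hg, norm_smul, mul_pow, Real.norm_eq_abs, sq_abs] at i1
  have i6 : γ / 4 * ‖c - xh‖ ^ 2 ≤ regGap f Y γ c c y₀ + regGap f Y γ c x₁ y₁ := by
    unfold regGap
    simp only [sub_self, norm_zero] at i5 ⊢
    linarith
  -- PL in x at xh, where the gradient is γ(c - xh); this is the only source of the factor γ/μx.
  have i7 : f xh y₁ - f xm y₁ ≤ 2 * (γ / μx) * (γ / 4 * ‖c - xh‖ ^ 2) := by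
    rw [show 2 * (γ / μx) * (γ / 4 * ‖c - xh‖ ^ 2) = γ ^ 2 * ‖c - xh‖ ^ 2 / (2 * μx) by
      field_simp; ring, le_div_iff₀ (by positivity)]
    linarith
  have i8 : 2 * (1 + γ / μx) * (γ / 4 * ‖c - xh‖ ^ 2)
      ≤ 2 * (1 + γ / μx) * (regGap f Y γ c c y₀ + regGap f Y γ c x₁ y₁) := by gcongr
  have i9 : 0 ≤ γ / 2 * ‖x₁ - c‖ ^ 2 := by positivity
  have e1 : dualityGap f Y x₁ y₁ = primalObj f Y x₁ - ⨅ x', f x' y₁ := rfl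
  have e2 : regGap f Y γ c x₁ y₁ = primalObj f Y x₁ + γ / 2 * ‖x₁ - c‖ ^ 2
    - (f xh y₁ + γ / 2 * ‖c - xh‖ ^ 2) := by rw [regGap, e, norm_sub_rev c]
  linarith

end MinMaxAssumptions

/-! ### Projection onto Y and the closed form of a proximal step -/

section Projection

variable {F : Type*} [NormedAddCommGroup F] [InnerProductSpace ℝ F]

/-- The metric projection onto `Y`, through its variational characterization. -/
noncomputable def projOnto (Y : Set F) (w : F) : F :=
  Classical.epsilon fun v => v ∈ Y ∧ ∀ u ∈ Y, inner ℝ (w - v) (u - v) ≤ 0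

variable [CompleteSpace F] {Y : Set F}

theorem projOnto_spec (hc : IsClosed Y) (hY : Convex ℝ Y) (hne : Y.Nonempty) (w : F) :
    projOnto Y w ∈ Y ∧ ∀ u ∈ Y, inner ℝ (w - projOnto Y w) (u - projOnto Y w) ≤ 0 := by
  apply Classical.epsilon_spec (p := fun v => v ∈ Y ∧ ∀ u ∈ Y, inner ℝ (w - v) (u - v) ≤ 0)
  obtain ⟨v, hv, e⟩ := exists_norm_eq_iInf_of_complete_convex hne hc.isComplete hY w
  exact ⟨v, hv, (norm_eq_iInf_iff_real_inner_le_zero hY hv).1 e⟩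

/-- Adding the two variational inequalities and using Cauchy–Schwarz. Continuity of the projection
is what makes the iterates measurable. -/
theorem lipschitzWith_projOnto (hc : IsClosed Y) (hY : Convex ℝ Y) (hne : Y.Nonempty) :
    LipschitzWith 1 (projOnto Y) := by
  refine LipschitzWith.mk_one fun w w' => ?_
  obtain ⟨h1, h2⟩ := projOnto_spec hc hY hne w
  obtain ⟨h1', h2'⟩ := projOnto_spec hc hY hne w'
  set v := projOnto Y w
  set v' := projOnto Y w'
  have i1 := h2 v' h1'
  have i2 := h2' v h1
  have e : inner ℝ (w - w') (v - v')
      = ‖v - v'‖ ^ 2 - inner ℝ (w - v) (v' - v) - inner ℝ (w' - v') (v - v') := by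
    rw [← real_inner_self_eq_norm_sq, ← neg_sub v v', inner_neg_right, sub_neg_eq_add,
      ← inner_add_left, ← inner_sub_left]
    congr 1; abel
  have i3 := real_inner_le_norm (w - w') (v - v')
  rw [dist_eq_norm, dist_eq_norm]
  rcases (norm_nonneg (v - v')).eq_or_lt with h0 | h0
  · rw [← h0]; positivity
  · refine le_of_mul_le_mul_right ?_ h0
    nlinarith

end Projection

section ProxStep

variable {E F : Type*} [NormedAddCommGroup E] [InnerProductSpace ℝ E]
  [NormedAddCommGroup F] [InnerProductSpace ℝ F] [CompleteSpace F] {Y : Set F}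

/-- Quadratic growth of the objective of a regularized gradient step. -/
theorem proxStep_growth_x {V : Type*} [NormedAddCommGroup V] [InnerProductSpace ℝ V] {a : ℝ}
    (ha : 0 ≤ a) (c b g u : V) {p : V} (hp : p = (1 + a)⁻¹ • (b + a • c - g)) :
    inner ℝ g p + 1 / 2 * ‖p - b‖ ^ 2 + a / 2 * ‖p - c‖ ^ 2 + (1 + a) / 2 * ‖u - p‖ ^ 2
      = inner ℝ g u + 1 / 2 * ‖u - b‖ ^ 2 + a / 2 * ‖u - c‖ ^ 2 := by
  have h1 : g = b + a • c - (1 + a) • p := by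
    rw [hp, smul_smul, mul_inv_cancel₀ (by positivity), one_smul]; abel
  have e1 : ‖u - b‖ ^ 2 = ‖u - p‖ ^ 2 + 2 * inner ℝ (p - b) (u - p) + ‖p - b‖ ^ 2 := by
    rw [real_inner_comm, ← norm_add_sq_real]; congr 2; abel
  have e2 : ‖u - c‖ ^ 2 = ‖u - p‖ ^ 2 + 2 * inner ℝ (p - c) (u - p) + ‖p - c‖ ^ 2 := by
    rw [real_inner_comm, ← norm_add_sq_real]; congr 2; abel
  have e3 : inner ℝ g u = inner ℝ g p + inner ℝ g (u - p) := by
    rw [← inner_add_right]; congr 1; abel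
  have e4 : inner ℝ g (u - p) = - inner ℝ (p - b) (u - p) - a * inner ℝ (p - c) (u - p) := by
    rw [← real_inner_smul_left, ← inner_neg_left, ← inner_sub_left]
    congr 1; rw [h1]; module
  rw [e1, e2, e3, e4]
  ring

/-- Quadratic growth of the objective of a projected gradient step. -/
theorem proxStep_growth_y (hc : IsClosed Y) (hY : Convex ℝ Y) (hne : Y.Nonempty) (b g : F)
    {u : F} (hu : u ∈ Y) {p : F} (hp : p = projOnto Y (b - g)) :
    inner ℝ g p + 1 / 2 * ‖p - b‖ ^ 2 + 1 / 2 * ‖u - p‖ ^ 2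
      ≤ inner ℝ g u + 1 / 2 * ‖u - b‖ ^ 2 := by
  have h := (projOnto_spec hc hY hne (b - g)).2 u hu
  rw [← hp] at h
  have e1 : ‖u - b‖ ^ 2 = ‖u - p‖ ^ 2 + 2 * inner ℝ (p - b) (u - p) + ‖p - b‖ ^ 2 := by
    rw [real_inner_comm, ← norm_add_sq_real]; congr 2; abel
  have e3 : inner ℝ g u = inner ℝ g p + inner ℝ g (u - p) := by
    rw [← inner_add_right]; congr 1; abel
  have e4 : inner ℝ (b - g - p) (u - p) = - inner ℝ (p - b) (u - p) - inner ℝ g (u - p) := by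
    rw [← inner_neg_left, ← inner_sub_left]
    congr 1; abel
  rw [e1, e3]
  linarith

/-- The proximal step is a damped gradient step in `x` and a projected gradient step in `y`. -/
theorem proxStep_eq (hc : IsClosed Y) (hY : Convex ℝ Y) (hne : Y.Nonempty) {a : ℝ} (ha : 0 ≤ a)
    (x₀ : E) (zbar g : E × F) :
    proxStep Y a x₀ zbar g
      = ((1 + a)⁻¹ • (zbar.1 + a • x₀ - g.1), projOnto Y (zbar.2 - g.2)) := by
  set p := (1 + a)⁻¹ • (zbar.1 + a • x₀ - g.1) with hp
  set q := projOnto Y (zbar.2 - g.2) with hq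
  have hqY : q ∈ Y := (projOnto_spec hc hY hne _).1
  have key : ∀ w : E × F, w.2 ∈ Y → proxObj a x₀ zbar g (p, q)
      + 1 / 2 * ‖w.1 - p‖ ^ 2 + 1 / 2 * ‖w.2 - q‖ ^ 2 ≤ proxObj a x₀ zbar g w := fun w hw => by
    have h1 := proxStep_growth_x ha x₀ zbar.1 g.1 w.1 hp
    have h2 := proxStep_growth_y hc hY hne zbar.2 g.2 hw hq
    have h3 : 0 ≤ a / 2 * ‖w.1 - p‖ ^ 2 := by positivity
    simp only [proxObj]
    linarith
  obtain ⟨h1, h2⟩ := Classical.epsilon_spec (p := fun z : E × F =>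
    z.2 ∈ Y ∧ ∀ w : E × F, w.2 ∈ Y → proxObj a x₀ zbar g z ≤ proxObj a x₀ zbar g w)
    ⟨(p, q), hqY, fun w hw => by
      have := key w hw
      have : 0 ≤ 1 / 2 * ‖w.1 - p‖ ^ 2 := by positivity
      have : 0 ≤ 1 / 2 * ‖w.2 - q‖ ^ 2 := by positivity
      linarith⟩
  change (proxStep Y a x₀ zbar g).2 ∈ Y at h1
  change ∀ w : E × F, w.2 ∈ Y → proxObj a x₀ zbar g (proxStep Y a x₀ zbar g) ≤ _ at h2
  have h3 := h2 (p, q) hqY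
  have h4 := key _ h1
  have h5 := sq_nonneg ‖(proxStep Y a x₀ zbar g).1 - p‖
  have h6 := sq_nonneg ‖(proxStep Y a x₀ zbar g).2 - q‖
  ext1
  · exact sub_eq_zero.1 (norm_eq_zero.1 (pow_eq_zero_iff two_ne_zero |>.1 (by linarith)))
  · exact sub_eq_zero.1 (norm_eq_zero.1 (pow_eq_zero_iff two_ne_zero |>.1 (by linarith)))

end ProxStep

/-! ### Regret of a regularized stochastic gradient method in one variable -/

section OneSided

variable {V : Type*} [NormedAddCommGroup V] [InnerProductSpace ℝ V]

/-- The error term of `T` steps of a stochastic gradient method with step size `η`, iterates `x`,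
stochastic gradients `g` and exact gradients `G`. -/
noncomputable def epochNoise (η : ℝ) (T : ℕ) (x g G : ℕ → V) : ℝ :=
  η ^ 2 * (10 * ‖g 0‖ ^ 2 + 1 / 2 * ∑ t ∈ Finset.Icc 1 T, ‖g t‖ ^ 2)
    + η * ∑ t ∈ Finset.Icc 1 T, inner ℝ (G t - g t) (x t - x 0)
    + 2 * η ^ 2 * ‖∑ t ∈ Finset.Icc 1 T, (G t - g t)‖ ^ 2

/-- `x` follows regularized gradient steps on `K`, with step size `η`, regularization weight
`w / η` and gradients `g`. -/
def IsProxSeq (K : Set V) (η w : ℝ) (x g : ℕ → V) : Prop :=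
  ∀ t, ∀ u ∈ K, η * inner ℝ (g t) (x (t + 1) - u) + 1 / 2 * ‖x (t + 1) - x t‖ ^ 2
    + w / 2 * ‖x (t + 1) - x 0‖ ^ 2 + (1 + w) / 2 * ‖u - x (t + 1)‖ ^ 2
      ≤ 1 / 2 * ‖u - x t‖ ^ 2 + w / 2 * ‖u - x 0‖ ^ 2

variable {K : Set V} {η w : ℝ} {x g : ℕ → V}

/-- The average runs over the iterates 1, …, T, so the telescoping starts at x 1; this bound brings
the distances back to x 0. -/
theorem IsProxSeq.norm_first_le (h : IsProxSeq K η w x g) (hη : 0 ≤ η)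
    (h0 : x 0 ∈ K) : (1 + w) * ‖x 1 - x 0‖ ≤ η * ‖g 0‖ := by
  have h1 := h 0 _ h0
  rw [sub_self, norm_zero, norm_sub_rev (x 0)] at h1
  have h2 := (abs_le.1 (abs_real_inner_le_norm (g 0) (x 1 - x 0))).1
  rcases (norm_nonneg (x 1 - x 0)).eq_or_lt with h3 | h3
  · rw [← h3]; simp; positivity
  · refine le_of_mul_le_mul_right ?_ h3
    have := mul_le_mul_of_nonneg_left h2 hη
    simp only [zero_add] at h1
    nlinarith

/-- From testing the step with u = x 0. It serves to make every x t - x 0 square integrable. -/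
theorem IsProxSeq.norm_succ_le (h : IsProxSeq K η w x g) (hη : 0 ≤ η) (hw : 0 ≤ w)
    (h0 : x 0 ∈ K) (t : ℕ) : ‖x (t + 1) - x 0‖ ≤ ‖x t - x 0‖ + 2 * η * ‖g t‖ := by
  have h1 := h t _ h0
  rw [sub_self, norm_zero, norm_sub_rev (x 0), norm_sub_rev (x 0)] at h1
  have h2 := (abs_le.1 (abs_real_inner_le_norm (g t) (x (t + 1) - x 0))).1
  have h3 := mul_le_mul_of_nonneg_left h2 hη
  have h4 : 0 ≤ w * ‖x (t + 1) - x 0‖ ^ 2 := by positivity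
  have h5 : 0 ≤ η * ‖g t‖ := by positivity
  have h6 := sq_nonneg ‖x (t + 1) - x t‖
  by_contra! hcon
  have h7 := norm_nonneg (x t - x 0)
  have h8 : ‖x (t + 1) - x 0‖ * (‖x (t + 1) - x 0‖ - 2 * (η * ‖g t‖))
      ≤ ‖x t - x 0‖ ^ 2 := by nlinarith
  nlinarith

/-- The extra strong convexity w of the step pays for the weak convexity term r. The T-th summand
uses the step from x T to x (T + 1), so the gradient at x T enters although the average does not
depend on it. -/
theorem IsProxSeq.telescope (h : IsProxSeq K η w x g) {r : ℝ} (hrw : r ≤ w) {u : V} (hu : u ∈ K)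
    (T : ℕ) :
    ∑ t ∈ Finset.Icc 1 T, (η * inner ℝ (g t) (x t - u) + r / 2 * ‖u - x t‖ ^ 2
        + w / 2 * ‖x t - x 0‖ ^ 2 - w / 2 * ‖u - x 0‖ ^ 2)
      + (1 + r) / 2 * ‖u - x (T + 1)‖ ^ 2 + w / 2 * ‖x (T + 1) - x 0‖ ^ 2
      ≤ (1 + r) / 2 * ‖u - x 1‖ ^ 2 + w / 2 * ‖x 1 - x 0‖ ^ 2
        + η ^ 2 / 2 * ∑ t ∈ Finset.Icc 1 T, ‖g t‖ ^ 2 := by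
  induction T with
  | zero => simp
  | succ T ih =>
    rw [Finset.sum_Icc_succ_top (by omega), Finset.sum_Icc_succ_top (by omega)]
    have h1 := h (T + 1) u hu
    have e : inner ℝ (g (T + 1)) (x (T + 1) - u) = inner ℝ (g (T + 1)) (x (T + 1 + 1) - u)
        - inner ℝ (g (T + 1)) (x (T + 1 + 1) - x (T + 1)) := by
      rw [← inner_sub_right]; congr 1; abel
    have h2 : 0 ≤ ‖η • g (T + 1) + (x (T + 1 + 1) - x (T + 1))‖ ^ 2 := by positivity
    rw [norm_add_sq_real, norm_smul, mul_pow, Real.norm_eq_abs, sq_abs,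
      real_inner_smul_left] at h2
    have h3 : 0 ≤ (w - r) / 2 * ‖u - x (T + 1 + 1)‖ ^ 2 := by
      have := sub_nonneg.2 hrw; positivity
    rw [e]
    linarith

/-- Regret bound of a regularized stochastic gradient method, for a comparator which may depend on
the noise. -/
theorem IsProxSeq.regret (h : IsProxSeq K η w x g) (hη : 0 ≤ η) {r : ℝ} (hr : 0 ≤ r) (hr1 : r ≤ 1)
    (hrw : r ≤ w) (h0 : x 0 ∈ K) {u : V} (hu : u ∈ K) (G : ℕ → V) (T : ℕ) :
    ∑ t ∈ Finset.Icc 1 T, (η * inner ℝ (G t) (x t - u) + r / 2 * ‖u - x t‖ ^ 2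
        + w / 2 * ‖x t - x 0‖ ^ 2 - w / 2 * ‖u - x 0‖ ^ 2)
      ≤ 5 / 4 * ‖u - x 0‖ ^ 2 + epochNoise η T x g G := by
  have hw : 0 ≤ w := hr.trans hrw
  have h1 := h.telescope hrw hu T
  have h2 := h.norm_first_le hη h0
  have h3 : (1 + r) / 2 * ‖u - x 1‖ ^ 2 ≤ 9 / 8 * ‖u - x 0‖ ^ 2 + 9 * ‖x 1 - x 0‖ ^ 2 := by
    have e : ‖u - x 1‖ ^ 2 = ‖u - x 0‖ ^ 2 - 2 * inner ℝ (u - x 0) (x 1 - x 0)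
        + ‖x 1 - x 0‖ ^ 2 := by
      rw [← norm_sub_sq_real]; congr 2; abel
    have i1 : 0 ≤ ‖(u - x 0) + (8 : ℝ) • (x 1 - x 0)‖ ^ 2 := by positivity
    rw [norm_add_sq_real, norm_smul, real_inner_smul_right, Real.norm_eq_abs, abs_of_pos] at i1 <;>
      try norm_num
    have i2 : (1 + r) / 2 * ‖u - x 1‖ ^ 2 ≤ 1 * ‖u - x 1‖ ^ 2 := by gcongr; linarith
    nlinarith
  have h4 : 9 * ‖x 1 - x 0‖ ^ 2 + w / 2 * ‖x 1 - x 0‖ ^ 2 ≤ 10 * η ^ 2 * ‖g 0‖ ^ 2 := by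
    have i1 : ((1 + w) * ‖x 1 - x 0‖) ^ 2 ≤ (η * ‖g 0‖) ^ 2 := by gcongr
    have i2 : 0 ≤ w * ‖x 1 - x 0‖ ^ 2 := by positivity
    have i3 : 0 ≤ w ^ 2 * ‖x 1 - x 0‖ ^ 2 := by positivity
    nlinarith
  have h5 : ∑ t ∈ Finset.Icc 1 T, (η * inner ℝ (G t) (x t - u) + r / 2 * ‖u - x t‖ ^ 2
        + w / 2 * ‖x t - x 0‖ ^ 2 - w / 2 * ‖u - x 0‖ ^ 2)
      = ∑ t ∈ Finset.Icc 1 T, (η * inner ℝ (g t) (x t - u) + r / 2 * ‖u - x t‖ ^ 2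
        + w / 2 * ‖x t - x 0‖ ^ 2 - w / 2 * ‖u - x 0‖ ^ 2)
        + η * ∑ t ∈ Finset.Icc 1 T, inner ℝ (G t - g t) (x t - x 0)
        + η * inner ℝ (∑ t ∈ Finset.Icc 1 T, (G t - g t)) (x 0 - u) := by
    rw [sum_inner, Finset.mul_sum, Finset.mul_sum, ← Finset.sum_add_distrib,
      ← Finset.sum_add_distrib]
    refine Finset.sum_congr rfl fun t _ => ?_
    have : inner ℝ (G t) (x t - u) = inner ℝ (g t) (x t - u) + inner ℝ (G t - g t) (x t - x 0)
        + inner ℝ (G t - g t) (x 0 - u) := by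
      rw [add_assoc, ← inner_add_right, sub_add_sub_cancel, ← inner_add_left, add_sub_cancel]
    rw [this]; ring
  -- Since u may depend on the noise, this term need not have mean zero. Its share 1/8 of ‖u - x 0‖²
  -- and the 9/8 from `h3` make up 5/4.
  have h6 : η * inner ℝ (∑ t ∈ Finset.Icc 1 T, (G t - g t)) (x 0 - u)
      ≤ 1 / 8 * ‖u - x 0‖ ^ 2 + 2 * η ^ 2 * ‖∑ t ∈ Finset.Icc 1 T, (G t - g t)‖ ^ 2 := by
    set D := ∑ t ∈ Finset.Icc 1 T, (G t - g t)
    have i1 : 0 ≤ ‖(u - x 0) + (4 * η) • D‖ ^ 2 := by positivity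
    rw [norm_add_sq_real, norm_smul, real_inner_smul_right, mul_pow, Real.norm_eq_abs, sq_abs] at i1
    rw [← neg_sub u (x 0), inner_neg_right, real_inner_comm]
    linarith
  have h7 : 0 ≤ (1 + r) / 2 * ‖u - x (T + 1)‖ ^ 2 := by positivity
  have h8 : 0 ≤ w / 2 * ‖x (T + 1) - x 0‖ ^ 2 := by positivity
  rw [h5]
  unfold epochNoise
  linarith

end OneSided

/-! ### Pathwise analysis of one epoch -/

section SgdaPath

variable {E F S : Type*} [NormedAddCommGroup E] [InnerProductSpace ℝ E]
  [NormedAddCommGroup F] [InnerProductSpace ℝ F] [CompleteSpace F] {Y : Set F}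
  {Gx : E → F → S → E} {Gy : E → F → S → F} {γ η : ℝ} {z₀ : E × F} {ξ : ℕ → S}

theorem sgdaIter_succ_eq (hc : IsClosed Y) (hY : Convex ℝ Y) (hne : Y.Nonempty) (hγη : 0 ≤ γ * η)
    (t : ℕ) : sgdaIter Y Gx Gy γ η z₀ ξ (t + 1)
      = ((1 + γ * η)⁻¹ • ((sgdaIter Y Gx Gy γ η z₀ ξ t).1 + (γ * η) • z₀.1
          - η • Gx (sgdaIter Y Gx Gy γ η z₀ ξ t).1 (sgdaIter Y Gx Gy γ η z₀ ξ t).2 (ξ t)),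
        projOnto Y ((sgdaIter Y Gx Gy γ η z₀ ξ t).2
          - -(η • Gy (sgdaIter Y Gx Gy γ η z₀ ξ t).1 (sgdaIter Y Gx Gy γ η z₀ ξ t).2 (ξ t)))) :=
  proxStep_eq hc hY hne hγη _ _ _

theorem sgdaIter_snd_mem (hc : IsClosed Y) (hY : Convex ℝ Y) (h₀ : z₀.2 ∈ Y) (hγη : 0 ≤ γ * η)
    (t : ℕ) : (sgdaIter Y Gx Gy γ η z₀ ξ t).2 ∈ Y := by
  cases t with
  | zero => exact h₀
  | succ t =>
    rw [sgdaIter_succ_eq hc hY ⟨_, h₀⟩ hγη]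
    exact (projOnto_spec hc hY ⟨_, h₀⟩ _).1

theorem isProxSeq_sgdaIter_fst (hc : IsClosed Y) (hY : Convex ℝ Y) (hne : Y.Nonempty)
    (hγη : 0 ≤ γ * η) :
    IsProxSeq Set.univ η (γ * η) (fun t => (sgdaIter Y Gx Gy γ η z₀ ξ t).1) (fun t =>
      Gx (sgdaIter Y Gx Gy γ η z₀ ξ t).1 (sgdaIter Y Gx Gy γ η z₀ ξ t).2 (ξ t)) := by
  intro t u _
  have h := proxStep_growth_x hγη z₀.1 (sgdaIter Y Gx Gy γ η z₀ ξ t).1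
    (η • Gx (sgdaIter Y Gx Gy γ η z₀ ξ t).1 (sgdaIter Y Gx Gy γ η z₀ ξ t).2 (ξ t)) u
    (congrArg Prod.fst (sgdaIter_succ_eq hc hY hne hγη t))
  rw [real_inner_smul_left, real_inner_smul_left] at h
  have e : sgdaIter Y Gx Gy γ η z₀ ξ 0 = z₀ := rfl
  simp only [inner_sub_right, e]
  linarith

theorem isProxSeq_sgdaIter_snd (hc : IsClosed Y) (hY : Convex ℝ Y) (hne : Y.Nonempty)
    (hγη : 0 ≤ γ * η) :
    IsProxSeq Y η 0 (fun t => (sgdaIter Y Gx Gy γ η z₀ ξ t).2) (fun t =>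
      -Gy (sgdaIter Y Gx Gy γ η z₀ ξ t).1 (sgdaIter Y Gx Gy γ η z₀ ξ t).2 (ξ t)) := by
  intro t u hu
  have h := proxStep_growth_y hc hY hne (sgdaIter Y Gx Gy γ η z₀ ξ t).2
    (-(η • Gy (sgdaIter Y Gx Gy γ η z₀ ξ t).1 (sgdaIter Y Gx Gy γ η z₀ ξ t).2 (ξ t))) hu
    (congrArg Prod.snd (sgdaIter_succ_eq hc hY hne hγη t))
  rw [← smul_neg, real_inner_smul_left, real_inner_smul_left] at h
  simp only [inner_sub_right]
  linarith

variable [CompleteSpace E] {f : E → F → ℝ} {ell L ρ μ μx μy : ℝ}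

/-- The stochastic error of an epoch of SGDA. -/
noncomputable def sgdaNoise (f : E → F → ℝ) (Y : Set F) (Gx : E → F → S → E) (Gy : E → F → S → F)
    (γ η : ℝ) (T : ℕ) (z₀ : E × F) (ξ : ℕ → S) : ℝ :=
  let z := sgdaIter Y Gx Gy γ η z₀ ξ
  epochNoise η T (fun t => (z t).1) (fun t => Gx (z t).1 (z t).2 (ξ t))
      (fun t => gradient (fun u => f u (z t).2) (z t).1)
    + epochNoise η T (fun t => (z t).2) (fun t => -Gy (z t).1 (z t).2 (ξ t))
      (fun t => -gradient (fun v => f (z t).1 v) (z t).2)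

theorem MinMaxAssumptions.sgda_regret (h : MinMaxAssumptions f Y ell L ρ μ μx μy)
    (hμy : 0 < μy) (hγ : 0 < γ) (hρ : 0 ≤ ρ) (hργ : 2 * ρ ≤ γ) (hη : 0 < η) (hηρ : ρ * η ≤ 1)
    (h₀ : z₀.2 ∈ Y) (T : ℕ) (x : E) {y : F} (hy : y ∈ Y) :
    η * ∑ t ∈ Finset.Icc 1 T,
        ((f (sgdaIter Y Gx Gy γ η z₀ ξ t).1 y
            + γ / 2 * ‖(sgdaIter Y Gx Gy γ η z₀ ξ t).1 - z₀.1‖ ^ 2)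
          - (f x (sgdaIter Y Gx Gy γ η z₀ ξ t).2 + γ / 2 * ‖x - z₀.1‖ ^ 2))
      ≤ 5 / 4 * (‖x - z₀.1‖ ^ 2 + ‖y - z₀.2‖ ^ 2) + sgdaNoise f Y Gx Gy γ η T z₀ ξ := by
  have hγη : 0 ≤ γ * η := by positivity
  have hne : Y.Nonempty := ⟨_, h₀⟩
  have hmem := sgdaIter_snd_mem (Gx := Gx) (Gy := Gy) (ξ := ξ) h.closed_Y h.convex_Y h₀ hγη
  have h1 := (isProxSeq_sgdaIter_fst (Gx := Gx) (Gy := Gy) (z₀ := z₀) (ξ := ξ) h.closed_Y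
    h.convex_Y hne hγη).regret hη.le (r := ρ * η) (by positivity) hηρ
    (by gcongr; linarith) (Set.mem_univ _) (Set.mem_univ x) (fun t =>
      gradient (fun u => f u (sgdaIter Y Gx Gy γ η z₀ ξ t).2) (sgdaIter Y Gx Gy γ η z₀ ξ t).1) T
  have h2 := (isProxSeq_sgdaIter_snd (Gx := Gx) (Gy := Gy) (z₀ := z₀) (ξ := ξ) h.closed_Y
    h.convex_Y hne hγη).regret hη.le le_rfl zero_le_one le_rfl h₀ hy (fun t =>
      -gradient (fun v => f (sgdaIter Y Gx Gy γ η z₀ ξ t).1 v) (sgdaIter Y Gx Gy γ η z₀ ξ t).2) T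
  have e : sgdaIter Y Gx Gy γ η z₀ ξ 0 = z₀ := rfl
  simp only [e] at h1 h2
  refine le_trans ?_ ((add_le_add h1 h2).trans_eq (by simp only [sgdaNoise]; ring))
  rw [Finset.mul_sum, ← Finset.sum_add_distrib]
  refine Finset.sum_le_sum fun t _ => ?_
  set z := sgdaIter Y Gx Gy γ η z₀ ξ t with hz
  have hzY : z.2 ∈ Y := hmem t
  have i1 := (h.weaklyConvex_x z.2 hzY).2 x z.1
  have i2 := (h.strongConcave_y z.1).le_gradient (h.diff_y z.1 z.2 hzY) hzY hy
  have i3 : 0 ≤ μy / 2 * ‖y - z.2‖ ^ 2 := by positivity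
  have i4 : f z.1 y - f x z.2 ≤ inner ℝ (gradient (fun u => f u z.2) z.1) (z.1 - x)
      + ρ / 2 * ‖x - z.1‖ ^ 2 + inner ℝ (-gradient (fun v => f z.1 v) z.2) (z.2 - y) := by
    rw [← neg_sub x z.1, ← neg_sub y z.2, inner_neg_neg, inner_neg_right]
    linarith
  have i5 := mul_le_mul_of_nonneg_left i4 hη.le
  linarith

variable [ProperSpace E] [ProperSpace F]

/-- One epoch of SGDA contracts the regularized gap up to the stochastic error. -/
theorem MinMaxAssumptions.sgda_regGap_le (h : MinMaxAssumptions f Y ell L ρ (4 * γ) μx μy)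
    (hμy : 0 < μy) (hγ : 0 < γ) (hρ : 0 ≤ ρ) (hργ : 2 * ρ ≤ γ) (hη : 0 < η) (hηρ : ρ * η ≤ 1)
    (h₀ : z₀.2 ∈ Y) {T : ℕ} (hT0 : 0 < T) (hT : 768 ≤ η * min (4 * γ / 8) μy * T) :
    ((T : ℝ)⁻¹ • ∑ t ∈ Finset.Icc 1 T, sgdaIter Y Gx Gy γ η z₀ ξ t).2 ∈ Y ∧
    regGap f Y γ z₀.1 ((T : ℝ)⁻¹ • ∑ t ∈ Finset.Icc 1 T, sgdaIter Y Gx Gy γ η z₀ ξ t).1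
        ((T : ℝ)⁻¹ • ∑ t ∈ Finset.Icc 1 T, sgdaIter Y Gx Gy γ η z₀ ξ t).2
      ≤ 1 / 300 * regGap f Y γ z₀.1 z₀.1 z₀.2
        + 1536 / 1531 / (η * T) * sgdaNoise f Y Gx Gy γ η T z₀ ξ := by
  have hγη : 0 ≤ γ * η := by positivity
  have hmem := sgdaIter_snd_mem (Gx := Gx) (Gy := Gy) (ξ := ξ) h.closed_Y h.convex_Y h₀ hγη
  set z := sgdaIter Y Gx Gy γ η z₀ ξ with hz
  have hT0' : (0 : ℝ) < T := by exact_mod_cast hT0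
  have e1 : ((T : ℝ)⁻¹ • ∑ t ∈ Finset.Icc 1 T, z t).1
      = (T : ℝ)⁻¹ • ∑ t ∈ Finset.Icc 1 T, (z t).1 := by rw [Prod.smul_fst, Prod.fst_sum]
  have e2 : ((T : ℝ)⁻¹ • ∑ t ∈ Finset.Icc 1 T, z t).2
      = (T : ℝ)⁻¹ • ∑ t ∈ Finset.Icc 1 T, (z t).2 := by rw [Prod.smul_snd, Prod.snd_sum]
  rw [e1, e2]
  have hsum1 : ∑ _t ∈ Finset.Icc 1 T, (T : ℝ)⁻¹ = 1 := by
    simp [hT0'.ne']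
  have hY : (T : ℝ)⁻¹ • ∑ t ∈ Finset.Icc 1 T, (z t).2 ∈ Y := by
    rw [Finset.smul_sum]
    exact h.convex_Y.sum_mem (fun _ _ => by positivity) hsum1 (fun t _ => hmem t)
  refine ⟨hY, ?_⟩
  set xb := (T : ℝ)⁻¹ • ∑ t ∈ Finset.Icc 1 T, (z t).1 with hxb
  set yb := (T : ℝ)⁻¹ • ∑ t ∈ Finset.Icc 1 T, (z t).2 with hyb
  obtain ⟨xh, yh, hyh, eG, hdist⟩ := h.exists_best_responses hμy hγ hργ h₀ hY z₀.1 xb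
  have j1 : (T : ℝ) * (f xb yh + γ / 2 * ‖xb - z₀.1‖ ^ 2)
      ≤ ∑ t ∈ Finset.Icc 1 T, (f (z t).1 yh + γ / 2 * ‖(z t).1 - z₀.1‖ ^ 2) := by
    have := (h.weaklyConvex_x yh hyh).map_average_le (γ := γ) (by linarith) z₀.1
      (Finset.Icc 1 T) ⟨1, by simp; omega⟩ (fun t => (z t).1)
    simpa [hxb] using this
  have j2 : ∑ t ∈ Finset.Icc 1 T, f xh (z t).2 ≤ (T : ℝ) * f xh yb := by
    have := (((h.strongConcave_y xh).strictConcaveOn hμy).concaveOn).le_map_sum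
      (t := Finset.Icc 1 T) (w := fun _ => (T : ℝ)⁻¹) (p := fun t => (z t).2)
      (fun _ _ => by positivity) hsum1 (fun t _ => hmem t)
    rw [← Finset.smul_sum, ← Finset.smul_sum, ← hyb, smul_eq_mul, inv_mul_le_iff₀ hT0'] at this
    exact this
  have j3 := h.sgda_regret (Gx := Gx) (Gy := Gy) (ξ := ξ) hμy hγ hρ hργ hη hηρ h₀ T xh hyh
  rw [Finset.sum_sub_distrib, Finset.sum_add_distrib (g := fun _ => γ / 2 * ‖xh - z₀.1‖ ^ 2),
    Finset.sum_const, Nat.card_Icc, Nat.add_sub_cancel, nsmul_eq_mul, ← hz] at j3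
  set N := sgdaNoise f Y Gx Gy γ η T z₀ ξ
  set M := min (4 * γ / 8) μy with hM
  have hM0 : 0 < M := lt_min (by positivity) hμy
  set G := regGap f Y γ z₀.1 xb yb
  set H := regGap f Y γ z₀.1 z₀.1 z₀.2
  have j4 : η * T * G ≤ 5 / 4 * (‖xh - z₀.1‖ ^ 2 + ‖yh - z₀.2‖ ^ 2) + N := by
    refine le_trans ?_ j3
    rw [mul_assoc]
    gcongr
    rw [eG]
    linarith
  have j5 : M / 2 * (‖xh - z₀.1‖ ^ 2 + ‖yh - z₀.2‖ ^ 2) ≤ H + G := by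
    have a1 : M / 2 * ‖xh - z₀.1‖ ^ 2 ≤ γ / 4 * ‖xh - z₀.1‖ ^ 2 := by
      refine mul_le_mul_of_nonneg_right ?_ (sq_nonneg _)
      have := min_le_left (4 * γ / 8) μy
      linarith
    have a2 : M / 2 * ‖yh - z₀.2‖ ^ 2 ≤ μy / 2 * ‖yh - z₀.2‖ ^ 2 := by
      gcongr
      exact min_le_right _ _
    linarith
  have hH : 0 ≤ H := h.regGap_nonneg hμy hγ hργ h₀ _ _
  have hG : 0 ≤ G := h.regGap_nonneg hμy hγ hργ hY _ _
  have hηT : 0 < η * T := by positivity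
  -- From `j5` and 1/M ≤ ηT/768: the factor is 5/4 · 2/768 · ηT/2 · 2 = 5ηT/1536. Solving for G then
  -- gives 5/1531 ≤ 1/300 and the factor 1536/1531 of the noise.
  have j6 : 5 / 4 * (‖xh - z₀.1‖ ^ 2 + ‖yh - z₀.2‖ ^ 2) ≤ η * T * (5 / 1536 * (H + G)) := by
    have a1 : 768 * (5 / 4 * (‖xh - z₀.1‖ ^ 2 + ‖yh - z₀.2‖ ^ 2))
        ≤ (η * M * T) * (5 / 4 * (‖xh - z₀.1‖ ^ 2 + ‖yh - z₀.2‖ ^ 2)) := by gcongr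
    have a2 := mul_le_mul_of_nonneg_left j5 hηT.le
    linarith
  have j7 : G ≤ 5 / 1536 * (H + G) + N / (η * T) := by
    rw [← sub_le_iff_le_add', le_div_iff₀ hηT]
    linarith
  have j8 : 1536 / 1531 / (η * T) * N = 1536 / 1531 * (N / (η * T)) := by ring
  rw [j8]
  linarith

end SgdaPath

/-! ### Square-integrable vectors and integration over an independent sample -/

section SecondMoment

variable {Ω V : Type*} [MeasurableSpace Ω] [NormedAddCommGroup V] {Pr : Measure Ω}

theorem eLpNorm_two_sq (g : Ω → V) : eLpNorm g 2 Pr ^ 2 = ∫⁻ ω, ‖g ω‖ₑ ^ 2 ∂Pr := by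
  simpa using eLpNorm_nnreal_pow_eq_lintegral (p := 2) (f := g) (μ := Pr) (by norm_num)

theorem memLp_two_of_lintegral_lt_top {g : Ω → V} (hg : AEStronglyMeasurable g Pr)
    (h : ∫⁻ ω, ‖g ω‖ₑ ^ 2 ∂Pr < ⊤) : MemLp g 2 Pr := by
  refine ⟨hg, ?_⟩
  rw [← eLpNorm_two_sq] at h
  by_contra hcon
  rw [not_lt, top_le_iff] at hcon
  simp [hcon] at h

theorem integral_norm_sq_eq {g : Ω → V} (hg : AEStronglyMeasurable g Pr) :
    ∫ ω, ‖g ω‖ ^ 2 ∂Pr = (∫⁻ ω, ‖g ω‖ₑ ^ 2 ∂Pr).toReal := by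
  rw [integral_eq_lintegral_of_nonneg_ae (f := fun ω => ‖g ω‖ ^ 2)
    (Eventually.of_forall fun _ => by positivity) (hg.norm.pow 2)]
  congr 1
  refine lintegral_congr fun ω => ?_
  rw [ENNReal.ofReal_pow (norm_nonneg _), ofReal_norm]

variable [InnerProductSpace ℝ V]

theorem MeasureTheory.MemLp.integrable_inner_of_two {u v : Ω → V} (hu : MemLp u 2 Pr)
    (hv : MemLp v 2 Pr) : Integrable (fun ω => (inner ℝ (u ω) (v ω) : ℝ)) Pr := by
  refine (hu.norm.integrable_mul hv.norm).mono (hu.1.inner hv.1)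
    (Eventually.of_forall fun ω => ?_)
  simpa using abs_real_inner_le_norm (u ω) (v ω)

theorem MeasureTheory.MemLp.integral_norm_sub_sq_le {u v : Ω → V} (hu : MemLp u 2 Pr)
    (hv : MemLp v 2 Pr) :
    ∫ ω, ‖u ω - v ω‖ ^ 2 ∂Pr ≤ 2 * ∫ ω, ‖u ω‖ ^ 2 ∂Pr + 2 * ∫ ω, ‖v ω‖ ^ 2 ∂Pr := by
  have h1 := hu.integrable_norm_pow (p := 2) (by norm_num)
  have h2 := hv.integrable_norm_pow (p := 2) (by norm_num)
  have h3 := (hu.sub hv).integrable_norm_pow (p := 2) (by norm_num)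
  rw [← integral_const_mul, ← integral_const_mul, ← integral_add (h1.const_mul 2) (h2.const_mul 2)]
  refine integral_mono h3 ((h1.const_mul 2).add (h2.const_mul 2)) fun ω => ?_
  have i := norm_sub_sq_real (u ω) (v ω)
  have j := norm_add_sq_real (u ω) (v ω)
  have k := sq_nonneg ‖u ω + v ω‖
  linarith

end SecondMoment

section Fubini

variable {Ω S Z V : Type*} [MeasurableSpace Ω] [MeasurableSpace S] [MeasurableSpace Z]
  [NormedAddCommGroup V] [InnerProductSpace ℝ V] [MeasurableSpace V] [BorelSpace V]
  [SecondCountableTopology V] {Pr : Measure Ω} [IsProbabilityMeasure Pr]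
  {G : Z → S → V} {z : Ω → Z} {ξ : Ω → S} {w : Ω → V}

/-- Conditioning on everything but an independent sample, tested against a random vector. -/
theorem integral_inner_of_indepFun [CompleteSpace V] (hG : Measurable (Function.uncurry G)) (hz : Measurable z)
    (hξ : Measurable ξ) (hw : Measurable w) (hind : IndepFun (fun ω => (z ω, w ω)) ξ Pr)
    (hL2 : MemLp (fun ω => G (z ω) (ξ ω)) 2 Pr) (hw2 : MemLp w 2 Pr)
    (hint : ∀ ω, Integrable (G (z ω)) (Pr.map ξ)) :
    ∫ ω, inner ℝ (G (z ω) (ξ ω)) (w ω) ∂Pr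
      = ∫ ω, inner ℝ (∫ s, G (z ω) s ∂(Pr.map ξ)) (w ω) ∂Pr := by
  have : IsProbabilityMeasure (Pr.map ξ) := Measure.isProbabilityMeasure_map hξ.aemeasurable
  have hzw : Measurable fun ω => (z ω, w ω) := hz.prodMk hw
  have hmap := (indepFun_iff_map_prod_eq_prod_map_map hzw.aemeasurable hξ.aemeasurable).1 hind
  set H : (Z × V) × S → ℝ := fun p => inner ℝ (G p.1.1 p.2) p.1.2 with hH
  have hHm : Measurable H := by
    have h1 : Measurable fun p : (Z × V) × S => G p.1.1 p.2 :=
      hG.comp (f := fun p : (Z × V) × S => (p.1.1, p.2)) (by fun_prop)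
    exact h1.inner (by fun_prop)
  have hHi : Integrable H ((Pr.map fun ω => (z ω, w ω)).prod (Pr.map ξ)) := by
    rw [← hmap, integrable_map_measure hHm.aestronglyMeasurable (hzw.prodMk hξ).aemeasurable]
    exact hL2.integrable_inner_of_two hw2
  calc ∫ ω, inner ℝ (G (z ω) (ξ ω)) (w ω) ∂Pr
      = ∫ p, H p ∂(Pr.map fun ω => ((z ω, w ω), ξ ω)) :=
        (integral_map (hzw.prodMk hξ).aemeasurable hHm.aestronglyMeasurable).symm
    _ = ∫ p, ∫ s, H (p, s) ∂(Pr.map ξ) ∂(Pr.map fun ω => (z ω, w ω)) := by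
        rw [hmap, integral_prod _ hHi]
    _ = ∫ ω, ∫ s, H ((z ω, w ω), s) ∂(Pr.map ξ) ∂Pr :=
        integral_map hzw.aemeasurable hHi.integral_prod_left.aestronglyMeasurable
    _ = _ := by
        refine integral_congr_ae (Eventually.of_forall fun ω => ?_)
        simp only [hH]
        rw [real_inner_comm, ← integral_inner (hint ω)]
        simp only [real_inner_comm]

/-- The conditional mean given everything but an independent sample has a smaller second moment. -/
theorem memLp_integral_of_indepFun (hG : Measurable (Function.uncurry G)) (hz : Measurable z)
    (hξ : Measurable ξ) (hind : IndepFun z ξ Pr)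
    (hL2 : MemLp (fun ω => G (z ω) (ξ ω)) 2 Pr) :
    MemLp (fun ω => ∫ s, G (z ω) s ∂(Pr.map ξ)) 2 Pr ∧
      ∫ ω, ‖∫ s, G (z ω) s ∂(Pr.map ξ)‖ ^ 2 ∂Pr ≤ ∫ ω, ‖G (z ω) (ξ ω)‖ ^ 2 ∂Pr := by
  have : IsProbabilityMeasure (Pr.map ξ) := Measure.isProbabilityMeasure_map hξ.aemeasurable
  have hmap := (indepFun_iff_map_prod_eq_prod_map_map hz.aemeasurable hξ.aemeasurable).1 hind
  have hm : StronglyMeasurable fun x => ∫ s, G x s ∂(Pr.map ξ) :=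
    StronglyMeasurable.integral_prod_right hG.stronglyMeasurable
  have hm' : StronglyMeasurable fun ω => ∫ s, G (z ω) s ∂(Pr.map ξ) := hm.comp_measurable hz
  have hGx : ∀ x, Measurable (G x) := fun x => hG.comp measurable_prodMk_left
  have hle : ∫⁻ ω, ‖∫ s, G (z ω) s ∂(Pr.map ξ)‖ₑ ^ 2 ∂Pr ≤ ∫⁻ ω, ‖G (z ω) (ξ ω)‖ₑ ^ 2 ∂Pr := by
    calc ∫⁻ ω, ‖∫ s, G (z ω) s ∂(Pr.map ξ)‖ₑ ^ 2 ∂Pr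
        ≤ ∫⁻ ω, ∫⁻ s, ‖G (z ω) s‖ₑ ^ 2 ∂(Pr.map ξ) ∂Pr := by
          refine lintegral_mono fun ω => ?_
          have h1 : eLpNorm (G (z ω)) 1 (Pr.map ξ) ≤ eLpNorm (G (z ω)) 2 (Pr.map ξ) :=
            eLpNorm_le_eLpNorm_of_exponent_le (by norm_num) (hGx _).aestronglyMeasurable
          rw [← eLpNorm_two_sq]
          gcongr
          exact (enorm_integral_le_lintegral_enorm _).trans
            (by rwa [eLpNorm_one_eq_lintegral_enorm] at h1)
      _ = ∫⁻ x, ∫⁻ s, ‖G x s‖ₑ ^ 2 ∂(Pr.map ξ) ∂(Pr.map z) := by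
          rw [lintegral_map (Measurable.lintegral_prod_right (hG.enorm.pow_const 2)) hz]
      _ = ∫⁻ p, ‖G p.1 p.2‖ₑ ^ 2 ∂((Pr.map z).prod (Pr.map ξ)) := by
          exact (lintegral_prod _ (hG.enorm.pow_const 2).aemeasurable).symm
      _ = ∫⁻ ω, ‖G (z ω) (ξ ω)‖ₑ ^ 2 ∂Pr := by
          rw [← hmap]
          exact lintegral_map (hG.enorm.pow_const 2) (hz.prodMk hξ)
  have hfin : ∫⁻ ω, ‖G (z ω) (ξ ω)‖ₑ ^ 2 ∂Pr < ⊤ := by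
    rw [← eLpNorm_two_sq]
    exact ENNReal.pow_lt_top hL2.eLpNorm_lt_top
  refine ⟨memLp_two_of_lintegral_lt_top hm'.aestronglyMeasurable (hle.trans_lt hfin), ?_⟩
  rw [integral_norm_sq_eq hm'.aestronglyMeasurable, integral_norm_sq_eq hL2.1]
  exact ENNReal.toReal_mono hfin.ne hle

end Fubini

/-! ### Expected stochastic error -/

section Noise

variable {Ω V : Type*} {mΩ : MeasurableSpace Ω}
  [NormedAddCommGroup V] [InnerProductSpace ℝ V] [MeasurableSpace V]
  [BorelSpace V] [SecondCountableTopology V] {Pr : Measure Ω}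

/-- Mean of the error term of a stochastic gradient method with unbiased gradients. -/
theorem integral_epochNoise_le {m : ℕ → MeasurableSpace Ω} (hmono : Monotone m)
    {x g G : ℕ → Ω → V} {T : ℕ} {η B : ℝ} (hT : 0 < T) (hη : 0 ≤ η)
    (hx : ∀ t, Measurable[m t] (x t)) (hG : ∀ t ≤ T, Measurable[m t] (G t))
    (hg : ∀ t, Measurable[m (t + 1)] (g t))
    (hg2 : ∀ t ≤ T, MemLp (g t) 2 Pr) (hG2 : ∀ t ≤ T, MemLp (G t) 2 Pr)
    (hgB : ∀ t ≤ T, ∫ ω, ‖g t ω‖ ^ 2 ∂Pr ≤ B ^ 2) (hGB : ∀ t ≤ T, ∫ ω, ‖G t ω‖ ^ 2 ∂Pr ≤ B ^ 2)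
    (horth : ∀ t ≤ T, ∀ w : Ω → V, Measurable[m t] w → MemLp w 2 Pr →
      ∫ ω, inner ℝ (g t ω) (w ω) ∂Pr = ∫ ω, inner ℝ (G t ω) (w ω) ∂Pr)
    (hm : ∀ t, m t ≤ mΩ)
    (hstep : ∀ t ω, ‖x (t + 1) ω - x 0 ω‖ ≤ ‖x t ω - x 0 ω‖ + 2 * η * ‖g t ω‖) :
    Integrable (fun ω => epochNoise η T (fun t => x t ω) (fun t => g t ω) (fun t => G t ω)) Pr ∧
      ∫ ω, epochNoise η T (fun t => x t ω) (fun t => g t ω) (fun t => G t ω) ∂Pr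
        ≤ 19 * η ^ 2 * B ^ 2 * T := by
  have hdx : ∀ t, Measurable[m t] fun ω => x t ω - x 0 ω := fun t =>
    (hx t).sub ((hx 0).mono (hmono (Nat.zero_le t)) le_rfl)
  have hx2 : ∀ t ≤ T, MemLp (fun ω => x t ω - x 0 ω) 2 Pr := by
    intro t
    induction t with
    | zero => intro _; simp
    | succ t ih =>
      intro ht
      refine ((ih (by omega)).norm.add ((hg2 t (by omega)).norm.const_mul (2 * η))).mono
        ((hdx (t + 1)).mono (hm _) le_rfl).aestronglyMeasurable (Eventually.of_forall fun ω => ?_)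
      refine (hstep t ω).trans (le_of_eq ?_)
      simp only [Pi.add_apply, Real.norm_eq_abs]
      rw [abs_of_nonneg (by positivity)]
  have hD2 : ∀ t ≤ T, MemLp (fun ω => G t ω - g t ω) 2 Pr := fun t ht => (hG2 t ht).sub (hg2 t ht)
  have hDm : ∀ t ≤ T, Measurable[m (t + 1)] fun ω => G t ω - g t ω := fun t ht =>
    ((hG t ht).mono (hmono t.le_succ) le_rfl).sub (hg t)
  have hDB : ∀ t ≤ T, ∫ ω, ‖G t ω - g t ω‖ ^ 2 ∂Pr ≤ 4 * B ^ 2 := fun t ht => by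
    have := (hG2 t ht).integral_norm_sub_sq_le (hg2 t ht)
    linarith [hgB t ht, hGB t ht]
  have hDo : ∀ t ≤ T, ∀ w : Ω → V, Measurable[m t] w → MemLp w 2 Pr →
      Integrable (fun ω => inner ℝ (G t ω - g t ω) (w ω)) Pr ∧
        ∫ ω, inner ℝ (G t ω - g t ω) (w ω) ∂Pr = 0 := fun t ht w hw hw2 => by
    refine ⟨(hD2 t ht).integrable_inner_of_two hw2, ?_⟩
    simp only [inner_sub_left]
    rw [integral_sub ((hG2 t ht).integrable_inner_of_two hw2) ((hg2 t ht).integrable_inner_of_two hw2),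
      horth t ht w hw hw2, sub_self]
  -- The error sums form a martingale: each increment is orthogonal to the past, so second moments
  -- add, at most 4B² per step.
  have hS : ∀ t ≤ T, Measurable[m (t + 1)] (fun ω => ∑ j ∈ Finset.Icc 1 t, (G j ω - g j ω)) ∧
      MemLp (fun ω => ∑ j ∈ Finset.Icc 1 t, (G j ω - g j ω)) 2 Pr ∧
      ∫ ω, ‖∑ j ∈ Finset.Icc 1 t, (G j ω - g j ω)‖ ^ 2 ∂Pr ≤ 4 * B ^ 2 * t := by
    intro t
    induction t with
    | zero => intro _; simp
    | succ t ih =>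
      intro ht
      obtain ⟨h1, h2, h3⟩ := ih (by omega)
      have e : ∀ ω, ∑ j ∈ Finset.Icc 1 (t + 1), (G j ω - g j ω)
          = ∑ j ∈ Finset.Icc 1 t, (G j ω - g j ω) + (G (t + 1) ω - g (t + 1) ω) := fun ω =>
        Finset.sum_Icc_succ_top (by omega) _
      simp only [e]
      refine ⟨(h1.mono (hmono (Nat.le_succ _)) le_rfl).add (hDm (t + 1) ht), h2.add (hD2 _ ht), ?_⟩
      obtain ⟨i1, i2⟩ := hDo (t + 1) ht _ h1 h2
      have j1 := h2.integrable_norm_pow (p := 2) (by norm_num)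
      have j2 := (hD2 _ ht).integrable_norm_pow (p := 2) (by norm_num)
      have e2 : ∀ ω, ‖∑ j ∈ Finset.Icc 1 t, (G j ω - g j ω) + (G (t + 1) ω - g (t + 1) ω)‖ ^ 2
          = (‖∑ j ∈ Finset.Icc 1 t, (G j ω - g j ω)‖ ^ 2
            + 2 * inner ℝ (G (t + 1) ω - g (t + 1) ω) (∑ j ∈ Finset.Icc 1 t, (G j ω - g j ω)))
            + ‖G (t + 1) ω - g (t + 1) ω‖ ^ 2 := fun ω => by
        rw [norm_add_sq_real, real_inner_comm]
      simp only [e2]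
      have e3 := integral_add (j1.add (i1.const_mul 2)) j2
      have e4 := integral_add j1 (i1.const_mul 2)
      rw [integral_const_mul, i2] at e4
      simp only [Pi.add_apply] at e3
      rw [e3, e4]
      push_cast
      linarith [hDB (t + 1) ht]
  obtain ⟨-, hS2, hSB⟩ := hS T le_rfl
  have a0 := (hg2 0 (Nat.zero_le _)).integrable_norm_pow (p := 2) (by norm_num)
  have a1 : ∀ t ∈ Finset.Icc 1 T, Integrable (fun ω => ‖g t ω‖ ^ 2) Pr := fun t ht =>
    (hg2 t (Finset.mem_Icc.1 ht).2).integrable_norm_pow (p := 2) (by norm_num)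
  have a2 := integrable_finsetSum _ a1
  have a3 : ∀ t ∈ Finset.Icc 1 T,
      Integrable (fun ω => inner ℝ (G t ω - g t ω) (x t ω - x 0 ω)) Pr := fun t ht =>
    (hDo t (Finset.mem_Icc.1 ht).2 _ (hdx t) (hx2 t (Finset.mem_Icc.1 ht).2)).1
  have a4 := integrable_finsetSum _ a3
  have a5 := hS2.integrable_norm_pow (p := 2) (by norm_num)
  have b1 : ∫ ω, ∑ t ∈ Finset.Icc 1 T, ‖g t ω‖ ^ 2 ∂Pr ≤ T * B ^ 2 := by
    rw [integral_finsetSum _ a1]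
    refine (Finset.sum_le_sum fun t ht => hgB t (Finset.mem_Icc.1 ht).2).trans_eq ?_
    simp
  have b2 : ∫ ω, ∑ t ∈ Finset.Icc 1 T, inner ℝ (G t ω - g t ω) (x t ω - x 0 ω) ∂Pr = 0 := by
    rw [integral_finsetSum _ a3]
    exact Finset.sum_eq_zero fun t ht =>
      (hDo t (Finset.mem_Icc.1 ht).2 _ (hdx t) (hx2 t (Finset.mem_Icc.1 ht).2)).2
  have c1 := ((a0.const_mul 10).add (a2.const_mul (1 / 2))).const_mul (η ^ 2)
  have c2 := a4.const_mul η
  have c3 := a5.const_mul (2 * η ^ 2)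
  refine ⟨(c1.add c2).add c3, ?_⟩
  have e : ∫ ω, epochNoise η T (fun t => x t ω) (fun t => g t ω) (fun t => G t ω) ∂Pr
      = η ^ 2 * (10 * ∫ ω, ‖g 0 ω‖ ^ 2 ∂Pr + 1 / 2 * ∫ ω, ∑ t ∈ Finset.Icc 1 T, ‖g t ω‖ ^ 2 ∂Pr)
        + η * ∫ ω, ∑ t ∈ Finset.Icc 1 T, inner ℝ (G t ω - g t ω) (x t ω - x 0 ω) ∂Pr
        + 2 * η ^ 2 * ∫ ω, ‖∑ t ∈ Finset.Icc 1 T, (G t ω - g t ω)‖ ^ 2 ∂Pr := by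
    have e1 := integral_add (a0.const_mul 10) (a2.const_mul (1 / 2))
    have e2 := integral_add c1 c2
    have e3 := integral_add (c1.add c2) c3
    rw [integral_const_mul, integral_const_mul] at e1
    rw [integral_const_mul, integral_const_mul] at e2
    rw [integral_const_mul (2 * η ^ 2)] at e3
    simp only [Pi.add_apply] at e1 e2 e3
    rw [e1] at e2
    rw [e2] at e3
    exact e3
  rw [e, b2, mul_zero, add_zero]
  have hT1 : (1 : ℝ) ≤ T := by exact_mod_cast hT
  have b0 := hgB 0 (Nat.zero_le _)
  have d1 : η ^ 2 * (10 * ∫ ω, ‖g 0 ω‖ ^ 2 ∂Pr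
      + 1 / 2 * ∫ ω, ∑ t ∈ Finset.Icc 1 T, ‖g t ω‖ ^ 2 ∂Pr)
      ≤ η ^ 2 * (10 * (B ^ 2 * T) + 1 / 2 * (T * B ^ 2)) := by
    -- T ≥ 1 absorbs the first-step term; altogether 10 + 1/2 + 8 ≤ 19.
    have : B ^ 2 ≤ B ^ 2 * T := le_mul_of_one_le_right (sq_nonneg B) hT1
    gcongr
    exact b0.trans this
  have d2 : 2 * η ^ 2 * ∫ ω, ‖∑ t ∈ Finset.Icc 1 T, (G t ω - g t ω)‖ ^ 2 ∂Pr
      ≤ 2 * η ^ 2 * (4 * B ^ 2 * T) := by gcongr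
  have d3 : 0 ≤ η ^ 2 * (B ^ 2 * T) := by positivity
  linarith

end Noise

/-! ### The filtration of the samples and conditional unbiasedness -/

section Past

variable {S Ω : Type*} [MeasurableSpace S]

/-- The σ-algebra generated by the samples before step `t` of epoch `k`. -/
@[reducible]
def pastSigma (ξ : ℕ → ℕ → Ω → S) (k t : ℕ) : MeasurableSpace Ω :=
  ⨆ p ∈ {p : ℕ × ℕ | p.1 < k ∨ p.1 = k ∧ p.2 < t}, MeasurableSpace.comap (ξ p.1 p.2) inferInstance

theorem pastSigma_mono (ξ : ℕ → ℕ → Ω → S) {k t k' t' : ℕ} (h : k < k' ∨ k = k' ∧ t ≤ t') :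
    pastSigma ξ k t ≤ pastSigma ξ k' t' := by
  refine biSup_mono fun p hp => ?_
  simp only [Set.mem_ofPred_eq] at hp ⊢
  omega

theorem measurable_pastSigma (ξ : ℕ → ℕ → Ω → S) (k t : ℕ) :
    Measurable[pastSigma ξ k (t + 1)] (ξ k t) := by
  have h : MeasurableSpace.comap (ξ k t) inferInstance ≤ pastSigma ξ k (t + 1) :=
    le_biSup (fun p : ℕ × ℕ => MeasurableSpace.comap (ξ p.1 p.2) inferInstance)
      (i := (k, t)) (by simp)
  exact (comap_measurable (ξ k t)).mono h le_rfl

variable [mΩ : MeasurableSpace Ω] {Pr : Measure Ω} {ξ : ℕ → ℕ → Ω → S}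

theorem pastSigma_le (hξ : ∀ k t, Measurable (ξ k t)) (k t : ℕ) : pastSigma ξ k t ≤ mΩ :=
  iSup₂_le fun p _ => (hξ p.1 p.2).comap_le

theorem indep_pastSigma (hξ : ∀ k t, Measurable (ξ k t))
    (hind : iIndepFun (fun p : ℕ × ℕ => ξ p.1 p.2) Pr) (k t : ℕ) :
    Indep (pastSigma ξ k t) (MeasurableSpace.comap (ξ k t) inferInstance) Pr := by
  have h := indep_iSup_of_disjoint (m := fun p : ℕ × ℕ =>
      MeasurableSpace.comap (ξ p.1 p.2) inferInstance) (fun p => (hξ p.1 p.2).comap_le) hind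
    (S := {p : ℕ × ℕ | p.1 < k ∨ p.1 = k ∧ p.2 < t}) (T := {(k, t)}) (by simp)
  simpa [pastSigma] using h

end Past

section Unbiased

variable {Ω S Z V : Type*} {m : MeasurableSpace Ω} [mΩ : MeasurableSpace Ω] [MeasurableSpace S] [MeasurableSpace Z]
  [NormedAddCommGroup V] [InnerProductSpace ℝ V] [CompleteSpace V] [MeasurableSpace V]
  [BorelSpace V] [SecondCountableTopology V] {Pr : Measure Ω} [IsProbabilityMeasure Pr]
  {G : Z → S → V} {z : Ω → Z} {ξ : Ω → S} {D : Ω → V} {B : ℝ}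

/-- A stochastic gradient with second moment at most `B ^ 2`, evaluated at a point which is
determined by the past, is unbiased conditionally on the past. -/
theorem unbiased_along_past (hG : Measurable (Function.uncurry G)) (hm : m ≤ mΩ)
    (hz : Measurable[m] z) (hξ : Measurable ξ)
    (hind : Indep m (MeasurableSpace.comap ξ inferInstance) Pr)
    (hint : ∀ ω, Integrable (fun ω' => G (z ω) (ξ ω')) Pr)
    (hD : ∀ ω, ∫ ω', G (z ω) (ξ ω') ∂Pr = D ω)
    (hB : ∫⁻ ω, ENNReal.ofReal (‖G (z ω) (ξ ω)‖ ^ 2) ∂Pr ≤ ENNReal.ofReal (B ^ 2)) :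
    Measurable[m] D ∧ MemLp (fun ω => G (z ω) (ξ ω)) 2 Pr ∧ MemLp D 2 Pr ∧
      ∫ ω, ‖G (z ω) (ξ ω)‖ ^ 2 ∂Pr ≤ B ^ 2 ∧ ∫ ω, ‖D ω‖ ^ 2 ∂Pr ≤ B ^ 2 ∧
      ∀ w : Ω → V, Measurable[m] w → MemLp w 2 Pr →
        ∫ ω, inner ℝ (G (z ω) (ξ ω)) (w ω) ∂Pr = ∫ ω, inner ℝ (D ω) (w ω) ∂Pr := by
  have : IsProbabilityMeasure (Pr.map ξ) := Measure.isProbabilityMeasure_map hξ.aemeasurable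
  have hGx : ∀ x, Measurable (G x) := fun x => hG.comp measurable_prodMk_left
  have hD' : (fun ω => ∫ s, G (z ω) s ∂(Pr.map ξ)) = D := funext fun ω => by
    rw [← hD ω, integral_map hξ.aemeasurable (hGx _).aestronglyMeasurable]
  have hint' : ∀ ω, Integrable (G (z ω)) (Pr.map ξ) := fun ω =>
    (integrable_map_measure (hGx _).aestronglyMeasurable hξ.aemeasurable).2 (hint ω)
  have hz' : Measurable z := hz.mono hm le_rfl
  have hDm : Measurable[m] D := by
    rw [← hD']
    exact (StronglyMeasurable.integral_prod_right hG.stronglyMeasurable).measurable.comp hz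
  have hGm : AEStronglyMeasurable (fun ω => G (z ω) (ξ ω)) Pr :=
    (hG.comp (hz'.prodMk hξ)).aestronglyMeasurable
  have hB' : ∫⁻ ω, ‖G (z ω) (ξ ω)‖ₑ ^ 2 ∂Pr ≤ ENNReal.ofReal (B ^ 2) := by
    refine le_of_eq_of_le (lintegral_congr fun ω => ?_) hB
    rw [ENNReal.ofReal_pow (norm_nonneg _), ofReal_norm]
  have hL2 := memLp_two_of_lintegral_lt_top hGm (hB'.trans_lt ENNReal.ofReal_lt_top)
  have hLB : ∫ ω, ‖G (z ω) (ξ ω)‖ ^ 2 ∂Pr ≤ B ^ 2 := by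
    rw [integral_norm_sq_eq hGm]
    exact ENNReal.toReal_le_of_le_ofReal (sq_nonneg _) hB'
  have hmean := memLp_integral_of_indepFun hG hz' hξ ((IndepFun_iff_Indep _ _ _).2 (indep_of_indep_of_le_left hind hz.comap_le)) hL2
  refine ⟨hDm, hL2, hD' ▸ hmean.1, hLB, ?_, fun w hw hw2 => ?_⟩
  · have := hmean.2.trans hLB
    simpa only [← hD'] using this
  · rw [integral_inner_of_indepFun hG hz' hξ (hw.mono hm le_rfl)
      ((IndepFun_iff_Indep _ _ _).2 (indep_of_indep_of_le_left hind (hz.prodMk hw).comap_le)) hL2 hw2 hint', ← hD']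

end Unbiased

/-! ### Measurability and expected error of an epoch -/

section Epoch

variable {E F S Ω : Type*}
  [NormedAddCommGroup E] [InnerProductSpace ℝ E] [CompleteSpace E] [MeasurableSpace E]
  [BorelSpace E] [SecondCountableTopology E]
  [NormedAddCommGroup F] [InnerProductSpace ℝ F] [CompleteSpace F] [MeasurableSpace F]
  [BorelSpace F] [SecondCountableTopology F]
  [MeasurableSpace S] [MeasurableSpace Ω] {Pr : Measure Ω}
  {f : E → F → ℝ} {Y : Set F} {Gx : E → F → S → E} {Gy : E → F → S → F}
  {ξ : ℕ → ℕ → Ω → S} {γ η B : ℝ} {z₀ : Ω → E × F}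

theorem IsUnbiasedOracle.measurable_sgdaIter (ho : IsUnbiasedOracle Pr f Y Gx Gy ξ)
    (hc : IsClosed Y) (hY : Convex ℝ Y) (hne : Y.Nonempty) (hγη : 0 ≤ γ * η) {k : ℕ}
    (hz₀ : Measurable[pastSigma ξ k 0] z₀) (t : ℕ) :
    Measurable[pastSigma ξ k t]
      fun ω => sgdaIter Y Gx Gy γ η (z₀ ω) (fun j => ξ k j ω) t := by
  induction t with
  | zero => exact hz₀
  | succ t ih =>
    have hz := ih.mono (pastSigma_mono ξ (Or.inr ⟨rfl, t.le_succ⟩)) le_rfl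
    have hz0 := hz₀.mono (pastSigma_mono ξ (k := k) (Or.inr ⟨rfl, Nat.zero_le (t + 1)⟩)) le_rfl
    have hzξ := hz.fst.prodMk (hz.snd.prodMk (measurable_pastSigma ξ k t))
    have hgx := ho.measurable_Gx.comp hzξ
    have hgy := ho.measurable_Gy.comp hzξ
    simp only [sgdaIter_succ_eq hc hY hne hγη]
    refine Measurable.prodMk ?_ ?_
    · exact ((hz.fst.add (hz0.fst.const_smul (γ * η))).sub (hgx.const_smul η)).const_smul _
    · exact (lipschitzWith_projOnto hc hY hne).continuous.measurable.comp
        (hz.snd.sub (hgy.const_smul η).neg)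

theorem IsUnbiasedOracle.integral_sgdaNoise_le [IsProbabilityMeasure Pr]
    (ho : IsUnbiasedOracle Pr f Y Gx Gy ξ)
    (hc : IsClosed Y) (hY : Convex ℝ Y) (hγη : 0 ≤ γ * η) (hη : 0 ≤ η) {k : ℕ}
    (hz₀ : Measurable[pastSigma ξ k 0] z₀) (hz₀Y : ∀ ω, (z₀ ω).2 ∈ Y) {T : ℕ} (hT : 0 < T)
    (hB : ∀ t ≤ T,
      let z : Ω → E × F := fun ω => sgdaIter Y Gx Gy γ η (z₀ ω) (fun j => ξ k j ω) t
      ∫⁻ ω, ENNReal.ofReal (‖Gx (z ω).1 (z ω).2 (ξ k t ω)‖ ^ 2) ∂Pr ≤ ENNReal.ofReal (B ^ 2) ∧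
      ∫⁻ ω, ENNReal.ofReal (‖Gy (z ω).1 (z ω).2 (ξ k t ω)‖ ^ 2) ∂Pr ≤ ENNReal.ofReal (B ^ 2)) :
    Integrable (fun ω => sgdaNoise f Y Gx Gy γ η T (z₀ ω) (fun j => ξ k j ω)) Pr ∧
      ∫ ω, sgdaNoise f Y Gx Gy γ η T (z₀ ω) (fun j => ξ k j ω) ∂Pr
        ≤ 38 * η ^ 2 * B ^ 2 * T := by
  obtain ⟨ω₀⟩ : Nonempty Ω := nonempty_of_isProbabilityMeasure Pr
  have hne : Y.Nonempty := ⟨_, hz₀Y ω₀⟩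
  set z : ℕ → Ω → E × F := fun t ω => sgdaIter Y Gx Gy γ η (z₀ ω) (fun j => ξ k j ω) t with hz
  have hzm : ∀ t, Measurable[pastSigma ξ k t] (z t) := ho.measurable_sgdaIter hc hY hne hγη hz₀
  have hzY : ∀ t ω, (z t ω).2 ∈ Y := fun t ω => sgdaIter_snd_mem hc hY (hz₀Y ω) hγη t
  have hmono : Monotone (pastSigma ξ k) := fun a b hab => pastSigma_mono ξ (Or.inr ⟨rfl, hab⟩)
  have hle := pastSigma_le ho.measurable_sample
  have hre : Measurable fun p : (E × F) × S => (p.1.1, p.1.2, p.2) := by fun_prop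
  have hx := fun t (ht : t ≤ T) => unbiased_along_past (m := pastSigma ξ k t)
    (G := fun (p : E × F) s => Gx p.1 p.2 s) (ho.measurable_Gx.comp hre) (hle k t) (hzm t)
    (ho.measurable_sample k t) (indep_pastSigma ho.measurable_sample ho.indep k t)
    (fun ω => ho.integrable_x k t _ _ (hzY t ω)) (fun ω => ho.unbiased_x k t _ _ (hzY t ω))
    (hB t ht).1
  have hy := fun t (ht : t ≤ T) => unbiased_along_past (m := pastSigma ξ k t)
    (G := fun (p : E × F) s => -Gy p.1 p.2 s) (ho.measurable_Gy.comp hre).neg (hle k t) (hzm t)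
    (D := fun ω => -gradient (fun v => f (z t ω).1 v) (z t ω).2)
    (ho.measurable_sample k t) (indep_pastSigma ho.measurable_sample ho.indep k t)
    (fun ω => (ho.integrable_y k t _ _ (hzY t ω)).neg)
    (fun ω => by rw [integral_neg, ho.unbiased_y k t _ _ (hzY t ω)])
    (by simpa only [norm_neg] using (hB t ht).2)
  have hg : ∀ t, Measurable[pastSigma ξ k (t + 1)] fun ω =>
      ((z t ω).1, (z t ω).2, ξ k t ω) := fun t =>
    have h := (hzm t).mono (hmono t.le_succ) le_rfl
    h.fst.prodMk (h.snd.prodMk (measurable_pastSigma ξ k t))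
  obtain ⟨i1, i2⟩ := integral_epochNoise_le (x := fun t ω => (z t ω).1)
    (g := fun t ω => Gx (z t ω).1 (z t ω).2 (ξ k t ω)) hmono hT hη (fun t => (hzm t).fst)
    (fun t ht => (hx t ht).1) (fun t => ho.measurable_Gx.comp (hg t))
    (fun t ht => (hx t ht).2.1) (fun t ht => (hx t ht).2.2.1) (fun t ht => (hx t ht).2.2.2.1)
    (fun t ht => (hx t ht).2.2.2.2.1) (fun t ht => (hx t ht).2.2.2.2.2) (hle k)
    (fun t ω => (isProxSeq_sgdaIter_fst hc hY hne hγη).norm_succ_le hη hγη (Set.mem_univ _) t)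
  obtain ⟨j1, j2⟩ := integral_epochNoise_le (x := fun t ω => (z t ω).2)
    (g := fun t ω => -Gy (z t ω).1 (z t ω).2 (ξ k t ω)) hmono hT hη (fun t => (hzm t).snd)
    (fun t ht => (hy t ht).1) (fun t => (ho.measurable_Gy.comp (hg t)).neg)
    (fun t ht => (hy t ht).2.1) (fun t ht => (hy t ht).2.2.1) (fun t ht => (hy t ht).2.2.2.1)
    (fun t ht => (hy t ht).2.2.2.2.1) (fun t ht => (hy t ht).2.2.2.2.2) (hle k)
    (fun t ω => (isProxSeq_sgdaIter_snd hc hY hne hγη).norm_succ_le hη le_rfl (hz₀Y ω) t)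
  refine ⟨i1.add j1, ?_⟩
  have e := integral_add i1 j1
  refine (le_of_eq e).trans ?_
  linarith

end Epoch

/-! ### Step sizes and epoch lengths -/

section Schedule

theorem stepSize_succ (η₀ : ℝ) (k : ℕ) :
    stepSize η₀ (k + 1) = η₀ * Real.exp (-(1 / 16)) ^ k := by
  rw [stepSize, ← Real.exp_nat_mul]
  congr 2
  push_cast
  ring

theorem stepSize_succ_pos {η₀ : ℝ} (h : 0 < η₀) (k : ℕ) : 0 < stepSize η₀ (k + 1) := by
  rw [stepSize_succ]; positivity

theorem stepSize_succ_le {η₀ : ℝ} (h : 0 < η₀) (k : ℕ) : stepSize η₀ (k + 1) ≤ η₀ := by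
  rw [stepSize_succ]
  exact mul_le_of_le_one_right h.le
    (pow_le_one₀ (Real.exp_nonneg _) (Real.exp_le_one_iff.2 (by norm_num)))

theorem epochLength_pos {η₀ μ μy : ℝ} (h : 0 < η₀) (hμ : 0 < μ) (hμy : 0 < μy) (k : ℕ) :
    0 < epochLength η₀ μ μy k := by
  have : 0 < min (μ / 8) μy := lt_min (by positivity) hμy
  exact Nat.ceil_pos.2 (by positivity)

theorem le_stepSize_mul_epochLength {η₀ μ μy : ℝ} (h : 0 < η₀) (hμ : 0 < μ) (hμy : 0 < μy)
    (k : ℕ) : 768 ≤ stepSize η₀ k * min (μ / 8) μy * epochLength η₀ μ μy k := by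
  have hM : 0 < min (μ / 8) μy := lt_min (by positivity) hμy
  have h1 := Nat.le_ceil (768 / (η₀ * min (μ / 8) μy) * Real.exp (((k : ℝ) - 1) / 16))
  have h2 : 0 ≤ stepSize η₀ k * min (μ / 8) μy := by unfold stepSize; positivity
  refine le_trans (le_of_eq ?_) (mul_le_mul_of_nonneg_left h1 h2)
  rw [stepSize, Real.exp_neg]
  field_simp

/-- The step size thus decays more slowly than the contraction factor 14/15 of the potential. -/
theorem fifteen_sixteenths_le_exp : (15 / 16 : ℝ) ≤ Real.exp (-(1 / 16)) := by
  have := Real.add_one_le_exp (-(1 / 16) : ℝ)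
  linarith

end Schedule

/-! ### Contraction of the potential -/

section Decrease

variable {E F : Type*} [NormedAddCommGroup E] [InnerProductSpace ℝ E] [CompleteSpace E]
  [ProperSpace E] [NormedAddCommGroup F] [InnerProductSpace ℝ F] [CompleteSpace F] [ProperSpace F]
  {f : E → F → ℝ} {Y : Set F} {ell L ρ μx μy γ : ℝ}

/-- One epoch decreases the potential, pathwise and up to the stochastic error. -/
theorem MinMaxAssumptions.epoch_decrease (h : MinMaxAssumptions f Y ell L ρ (4 * γ) μx μy)
    (hμx : 0 < μx) (hμy : 0 < μy) (hγ : 0 < γ) {xs : E}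
    (hργ : 2 * ρ ≤ γ) (hxs : ∀ x, primalObj f Y xs ≤ primalObj f Y x) {N : ℝ}
    {z z' : E × F} (hz : z.2 ∈ Y) (hz' : z'.2 ∈ Y)
    (hN : regGap f Y γ z.1 z'.1 z'.2 ≤ 1 / 300 * regGap f Y γ z.1 z.1 z.2 + N) :
    (primalObj f Y z'.1 - primalObj f Y xs) + regGap f Y γ z'.1 z'.1 z'.2 / 40
        ≤ 14 / 15 * ((primalObj f Y z.1 - primalObj f Y xs) + regGap f Y γ z.1 z.1 z.2 / 40)
          + 137 / 20 * N ∧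
      dualityGap f Y z'.1 z'.2 ≤ (1 + γ / μx) *
        (81 * ((primalObj f Y z.1 - primalObj f Y xs) + regGap f Y γ z.1 z.1 z.2 / 40) + 3 * N) := by
  have h1 := h.primal_decrease hμy hγ hργ hxs hz' z.1 z'.1
  have h2 := h.regGap_recenter hμy hγ hργ hxs hz' z.1 z'.1
  have h3 := h.dualityGap_le hμy hμx hγ hργ hz hz' z.1 z'.1
  have h4 := h.regGap_nonneg hμy hγ hργ hz z.1 z.1
  have h5 := h.regGap_nonneg hμy hγ hργ hz' z.1 z'.1
  have h6 := hxs z.1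
  -- The weight 1/40 balances both parts: 13/25 + 16/40 = 23/25 ≤ 14/15 for the primal part, and 6 +
  -- 34/40 = 137/20 with 137/6000 ≤ (14/15)/40 for the gap.
  refine ⟨by linarith, h3.trans ?_⟩
  have h7 : 1 ≤ 1 + γ / μx := le_add_of_nonneg_right (by positivity)
  have h8 := mul_le_mul_of_nonneg_right h7 h5
  have h9 : (1 + γ / μx) * (3 * regGap f Y γ z.1 z'.1 z'.2 + 2 * regGap f Y γ z.1 z.1 z.2)
      ≤ (1 + γ / μx) * (81 * ((primalObj f Y z.1 - primalObj f Y xs)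
        + regGap f Y γ z.1 z.1 z.2 / 40) + 3 * N) := by
    exact mul_le_mul_of_nonneg_left (by linarith) (by linarith)
  linarith

end Decrease

/-! ### Expected duality gap after K epochs -/

section Run

variable {E F S Ω : Type*}
  [NormedAddCommGroup E] [InnerProductSpace ℝ E] [CompleteSpace E] [MeasurableSpace E]
  [BorelSpace E] [SecondCountableTopology E]
  [NormedAddCommGroup F] [InnerProductSpace ℝ F] [CompleteSpace F] [MeasurableSpace F]
  [BorelSpace F]
  [MeasurableSpace S] [MeasurableSpace Ω] {Pr : Measure Ω}
  {f : E → F → ℝ} {Y : Set F} {Gx : E → F → S → E} {Gy : E → F → S → F}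
  {ξ : ℕ → ℕ → Ω → S} {ell L ρ μ μx μy γ η₀ ε₀ B : ℝ}
  {z₀ : E × F}

theorem MinMaxAssumptions.measurable_dualityGap (h : MinMaxAssumptions f Y ell L ρ μ μx μy)
    {z : Ω → E × F} (hz : Measurable z) (hY : ∀ ω, (z ω).2 ∈ Y) :
    Measurable fun ω => dualityGap f Y (z ω).1 (z ω).2 := by
  obtain ⟨D, hDc, hD⟩ := TopologicalSpace.exists_countable_dense E
  have : Countable D := hDc.to_subtype
  refine Measurable.sub (h.smooth_primal.1.continuous.measurable.comp hz.fst) ?_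
  -- Continuity in x reduces the infimum to a countable dense set, hence to a measurable one.
  have e : ∀ ω, ⨅ x', f x' (z ω).2 = ⨅ x' : D, f x' (z ω).2 := fun ω =>
    (hD.ciInf' (h.weaklyConvex_x _ (hY ω)).1.continuous).symm
  simp only [e]
  refine Measurable.iInf fun x' => ?_
  have hc : Continuous fun y : Y => f x' y := continuousOn_iff_continuous_domRestrict.1
    fun y hy => (h.diff_y x' y hy).continuousAt.continuousWithinAt
  exact hc.measurable.comp (hz.snd.subtype_mk (h := hY))

variable [SecondCountableTopology F] [ProperSpace E] [ProperSpace F]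

/-- The expected duality gap after `K` epochs. -/
theorem MinMaxAssumptions.integral_dualityGap_pesIter_le [IsProbabilityMeasure Pr]
    (h : MinMaxAssumptions f Y ell L ρ (4 * γ) μx μy) (hμx : 0 < μx) (hμy : 0 < μy) (hγ : 0 < γ)
    (hρ : 0 < ρ) (hργ : 2 * ρ ≤ γ) (hε₀ : 0 ≤ ε₀) (hη₀ : 0 < η₀) (hηρ : η₀ ≤ 1 / ρ)
    (h₀ : z₀.2 ∈ Y) (hgap : dualityGap f Y z₀.1 z₀.2 ≤ ε₀)
    (ho : IsUnbiasedOracle Pr f Y Gx Gy ξ)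
    (hB : BoundedGradientsAlongRun Pr B Y Gx Gy γ (stepSize η₀) (epochLength η₀ (4 * γ) μy) z₀ ξ)
    (K : ℕ) :
    let z : Ω → E × F := fun ω => pesIter Y Gx Gy γ (stepSize η₀) (epochLength η₀ (4 * γ) μy) z₀
      (fun i j => ξ i j ω) K
    Integrable (fun ω => dualityGap f Y (z ω).1 (z ω).2) Pr ∧
      ∫ ω, dualityGap f Y (z ω).1 (z ω).2 ∂Pr
        ≤ 6000000 * (4 * γ / μx + 1) * (ε₀ + η₀ * B ^ 2) * Real.exp (-(1 / 16)) ^ K := by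
  set z : ℕ → Ω → E × F := fun k ω => pesIter Y Gx Gy γ (stepSize η₀) (epochLength η₀ (4 * γ) μy) z₀
    (fun i j => ξ i j ω) k with hz
  set T := epochLength η₀ (4 * γ) μy with hTdef
  set q := Real.exp (-(1 / 16)) with hq
  have hq0 : 0 < q := Real.exp_pos _
  have hq15 : 15 / 16 ≤ q := fifteen_sixteenths_le_exp
  have hT : ∀ k, 0 < T k := epochLength_pos hη₀ (by positivity) hμy
  have hη : ∀ k, 0 < stepSize η₀ (k + 1) := stepSize_succ_pos hη₀
  set N : ℕ → Ω → ℝ := fun k ω => 1536 / 1531 / (stepSize η₀ (k + 1) * T (k + 1)) *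
    sgdaNoise f Y Gx Gy γ (stepSize η₀ (k + 1)) (T (k + 1)) (z k ω) (fun j => ξ (k + 1) j ω) with hN
  have hepoch : ∀ k ω, (z k ω).2 ∈ Y → (z (k + 1) ω).2 ∈ Y ∧
      regGap f Y γ (z k ω).1 (z (k + 1) ω).1 (z (k + 1) ω).2
        ≤ 1 / 300 * regGap f Y γ (z k ω).1 (z k ω).1 (z k ω).2 + N k ω := fun k ω hk =>
    h.sgda_regGap_le hμy hγ hρ.le hργ (hη k)
      (by
        have := (stepSize_succ_le hη₀ k).trans hηρ
        rwa [le_div_iff₀' hρ] at this) hk (hT _)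
      (le_stepSize_mul_epochLength hη₀ (by positivity) hμy _)
  have hzY : ∀ k ω, (z k ω).2 ∈ Y := fun k ω => by
    induction k with
    | zero => exact h₀
    | succ k ih => exact (hepoch k ω ih).1
  have hzm : ∀ k, Measurable[pastSigma ξ (k + 1) 0] (z k) := fun k => by
    induction k with
    | zero => exact measurable_const
    | succ k ih =>
      have h1 : ∀ t, Measurable[pastSigma ξ (k + 2) 0] fun ω =>
          sgdaIter Y Gx Gy γ (stepSize η₀ (k + 1)) (z k ω) (fun j => ξ (k + 1) j ω) t := fun t =>
        (ho.measurable_sgdaIter h.closed_Y h.convex_Y ⟨_, h₀⟩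
          (mul_nonneg hγ.le (hη k).le) ih t).mono (pastSigma_mono ξ (Or.inl (by omega))) le_rfl
      exact (Finset.measurable_fun_sum _ fun t _ => h1 t).const_smul ((T (k + 1) : ℝ)⁻¹)
  have hNoise : ∀ k, Integrable (N k) Pr ∧ ∫ ω, N k ω ∂Pr ≤ 39 * (η₀ * q ^ k) * B ^ 2 := fun k => by
    obtain ⟨i1, i2⟩ := ho.integral_sgdaNoise_le h.closed_Y h.convex_Y
      (mul_nonneg hγ.le (hη k).le) (hη k).le (hzm k) (hzY k) (hT (k + 1)) (hB k)
    refine ⟨i1.const_mul _, ?_⟩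
    have hT' : (0 : ℝ) < T (k + 1) := by exact_mod_cast hT (k + 1)
    have hη' := hη k
    rw [hN, integral_const_mul, ← stepSize_succ]
    refine (mul_le_mul_of_nonneg_left i2 (by positivity)).trans ?_
    rw [show 1536 / 1531 / (stepSize η₀ (k + 1) * T (k + 1)) *
      (38 * stepSize η₀ (k + 1) ^ 2 * B ^ 2 * T (k + 1))
      = 1536 * 38 / 1531 * stepSize η₀ (k + 1) * B ^ 2 by field_simp]
    gcongr
    norm_num
  obtain ⟨xs, hxs⟩ := h.primal_min
  -- 65000 ≥ 240 · 39 · 137/20, where 1/240 = 15/16 - 14/15 is the room left by the contraction.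
  set A := 2 * ε₀ + 65000 * (η₀ * B ^ 2) with hA
  -- An integrable majorant is propagated instead of the potential, whose measurability is then not
  -- needed.
  have hW : ∀ k, ∃ W : Ω → ℝ, Integrable W Pr ∧ (∀ ω, (primalObj f Y (z k ω).1 - primalObj f Y xs)
      + regGap f Y γ (z k ω).1 (z k ω).1 (z k ω).2 / 40 ≤ W ω) ∧ ∫ ω, W ω ∂Pr ≤ A * q ^ k := by
    intro k
    induction k with
    | zero =>
      refine ⟨fun _ => 2 * ε₀, integrable_const _, fun ω => ?_, ?_⟩
      · have h1 := h.primal_sub_le_dualityGap hμy h₀ z₀.1 xs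
        have h2 := h.regGap_le_dualityGap hγ h₀ z₀.1
        change primalObj f Y z₀.1 - primalObj f Y xs + regGap f Y γ z₀.1 z₀.1 z₀.2 / 40 ≤ 2 * ε₀
        linarith
      · have : 0 ≤ η₀ * B ^ 2 := by positivity
        simp only [integral_const, probReal_univ, one_smul, pow_zero, mul_one]
        linarith
    | succ k ih =>
      obtain ⟨W, h1, h2, h3⟩ := ih
      obtain ⟨n1, n2⟩ := hNoise k
      have w1 := h1.const_mul (14 / 15)
      have w2 := n1.const_mul (137 / 20)
      refine ⟨fun ω => 14 / 15 * W ω + 137 / 20 * N k ω, w1.add w2, fun ω => ?_, ?_⟩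
      · have := (h.epoch_decrease hμx hμy hγ hργ hxs (hzY k ω) (hzY (k + 1) ω)
          (hepoch k ω (hzY k ω)).2).1
        have := h2 ω
        linarith
      · rw [integral_add w1 w2, integral_const_mul, integral_const_mul]
        have hqk : 0 ≤ q ^ k := by positivity
        have p1 : 14 / 15 * A + 137 / 20 * 39 * (η₀ * B ^ 2) ≤ A * q := by
          have hb : 0 ≤ η₀ * B ^ 2 := by positivity
          have hA0 : 0 ≤ A := by positivity
          have := mul_le_mul_of_nonneg_left hq15 hA0
          linarith
        have p2 := mul_le_mul_of_nonneg_right p1 hqk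
        rw [pow_succ]
        linarith
  cases K with
  | zero =>
    refine ⟨show Integrable (fun _ => dualityGap f Y z₀.1 z₀.2) Pr from integrable_const _, ?_⟩
    change ∫ _, dualityGap f Y z₀.1 z₀.2 ∂Pr ≤ _
    simp only [integral_const, probReal_univ, one_smul, pow_zero, mul_one]
    refine hgap.trans ?_
    have p1 : 0 ≤ η₀ * B ^ 2 := by positivity
    have p2 : 1 ≤ 4 * γ / μx + 1 := le_add_of_nonneg_left (by positivity)
    have p3 := mul_le_mul_of_nonneg_right p2 (add_nonneg hε₀ p1)
    linarith
  | succ k =>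
    obtain ⟨W, h1, h2, h3⟩ := hW k
    obtain ⟨n1, n2⟩ := hNoise k
    have w1 := h1.const_mul 81
    have w2 := n1.const_mul 3
    have w3 := (w1.add w2).const_mul (1 + γ / μx)
    have hc : 0 ≤ 1 + γ / μx := by positivity
    have hle : ∀ ω, dualityGap f Y (z (k + 1) ω).1 (z (k + 1) ω).2
        ≤ (1 + γ / μx) * (81 * W ω + 3 * N k ω) := fun ω => by
      refine (h.epoch_decrease hμx hμy hγ hργ hxs (hzY k ω) (hzY (k + 1) ω)
        (hepoch k ω (hzY k ω)).2).2.trans ?_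
      gcongr
      exact h2 ω
    have hm : Measurable fun ω => dualityGap f Y (z (k + 1) ω).1 (z (k + 1) ω).2 :=
      h.measurable_dualityGap ((hzm (k + 1)).mono (pastSigma_le ho.measurable_sample _ _) le_rfl)
        (hzY (k + 1))
    have hint : Integrable (fun ω => dualityGap f Y (z (k + 1) ω).1 (z (k + 1) ω).2) Pr := by
      refine w3.mono hm.aestronglyMeasurable (Eventually.of_forall fun ω => ?_)
      rw [Real.norm_of_nonneg (h.dualityGap_nonneg hμy (hzY (k + 1) ω) _)]
      exact (hle ω).trans (le_abs_self _)
    refine ⟨hint, (integral_mono hint w3 hle).trans ?_⟩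
    have e := integral_add w1 w2
    rw [integral_const_mul, integral_const_mul] at e
    rw [integral_const_mul]
    simp only [Pi.add_apply] at e ⊢
    rw [e]
    have hb : 0 ≤ η₀ * B ^ 2 := by positivity
    have p1 : 81 * ∫ ω, W ω ∂Pr + 3 * ∫ ω, N k ω ∂Pr
        ≤ 5270000 * (ε₀ + η₀ * B ^ 2) * q ^ k := by
      have hqk : 0 ≤ q ^ k := by positivity
      have := mul_nonneg hε₀ hqk
      have := mul_nonneg hb hqk
      linarith
    have p2 : 5270000 * (ε₀ + η₀ * B ^ 2) * q ^ k
        ≤ 6000000 * (ε₀ + η₀ * B ^ 2) * q ^ (k + 1) := by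
      rw [pow_succ q]
      have : 0 ≤ (ε₀ + η₀ * B ^ 2) * q ^ k := by positivity
      have := mul_le_mul_of_nonneg_left hq15 this
      linarith
    have p3 : 1 + γ / μx ≤ 4 * γ / μx + 1 := by
      have : γ / μx ≤ 4 * γ / μx := by gcongr; linarith
      linarith
    calc (1 + γ / μx) * (81 * ∫ ω, W ω ∂Pr + 3 * ∫ ω, N k ω ∂Pr)
        ≤ (4 * γ / μx + 1) * (6000000 * (ε₀ + η₀ * B ^ 2) * q ^ (k + 1)) :=
          mul_le_mul p3 (p1.trans p2) (by
            have hW0 : 0 ≤ ∫ ω, (81 * W ω + 3 * N k ω) ∂Pr := by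
              have : 0 ≤ ∫ ω, (1 + γ / μx) * (81 * W ω + 3 * N k ω) ∂Pr :=
                integral_nonneg fun ω =>
                  (h.dualityGap_nonneg hμy (hzY (k + 1) ω) _).trans (hle ω)
              rw [integral_const_mul] at this
              exact (mul_nonneg_iff_of_pos_left (by positivity)).1 this
            rwa [e] at hW0) (by positivity)
      _ = _ := by ring

end Run

/-! ### Counting iterations -/

section Count

/-- Geometric sum with e^(1/16) - 1 ≥ 1/16, so 12288 = 16 · 768; the summand K pays for the
ceilings. -/
theorem sum_epochLength_le {η₀ μ μy : ℝ} (h : 0 < η₀) (hμ : 0 < μ) (hμy : 0 < μy) (K : ℕ) :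
    ((∑ k ∈ Finset.Icc 1 K, epochLength η₀ μ μy k : ℕ) : ℝ)
      ≤ 12288 / (η₀ * min (μ / 8) μy) * (Real.exp (K / 16) - 1) + K := by
  have hM : 0 < min (μ / 8) μy := lt_min (by positivity) hμy
  induction K with
  | zero => simp
  | succ K ih =>
    rw [Finset.sum_Icc_succ_top (by omega), Nat.cast_add]
    have h1 : (epochLength η₀ μ μy (K + 1) : ℝ)
        < 768 / (η₀ * min (μ / 8) μy) * Real.exp (K / 16) + 1 := by
      have := Nat.ceil_lt_add_one (R := ℝ)
        (a := 768 / (η₀ * min (μ / 8) μy) * Real.exp ((((K + 1 : ℕ) : ℝ) - 1) / 16)) (by positivity)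
      simpa [epochLength] using this
    have h2 : Real.exp (K / 16) * (1 / 16) ≤ Real.exp ((K + 1 : ℕ) / 16) - Real.exp (K / 16) := by
      have h3 : Real.exp ((K + 1 : ℕ) / 16) = Real.exp (K / 16) * Real.exp (1 / 16) := by
        rw [← Real.exp_add]; congr 1; push_cast; ring
      have h4 := mul_le_mul_of_nonneg_left (Real.add_one_le_exp (1 / 16 : ℝ))
        (Real.exp_nonneg (K / 16 : ℝ))
      rw [h3]
      linarith
    have h5 := mul_le_mul_of_nonneg_left h2
      (show 0 ≤ 12288 / (η₀ * min (μ / 8) μy) by positivity)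
    have h6 : 768 / (η₀ * min (μ / 8) μy) * Real.exp (K / 16)
        = 12288 / (η₀ * min (μ / 8) μy) * (Real.exp (K / 16) * (1 / 16)) := by ring
    push_cast at h5 ih ⊢
    linarith

/-- The number of epochs needed for a reduction by the factor `y`. -/
theorem exists_epoch_count {y : ℝ} (hy : 0 < y) :
    ∃ K : ℕ, y * Real.exp (-(1 / 16)) ^ K ≤ 1 ∧ Real.exp (K / 16) - 1 ≤ 2 * y ∧
      (K : ℝ) ≤ 16 * Real.log (1 + y) + 1 := by
  -- For y ≤ 1 the natural-number ceiling is 0, and the -1 in the second bound makes its left side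
  -- vanish.
  refine ⟨⌈16 * Real.log y⌉₊, ?_, ?_, ?_⟩
  · have h1 := Nat.le_ceil (16 * Real.log y)
    rw [← Real.exp_nat_mul]
    calc y * Real.exp (⌈16 * Real.log y⌉₊ * -(1 / 16)) ≤ y * Real.exp (-Real.log y) := by
          gcongr
          linarith
      _ = 1 := by rw [Real.exp_neg, Real.exp_log hy, mul_inv_cancel₀ hy.ne']
  · rcases le_total y 1 with h | h
    · have : ⌈16 * Real.log y⌉₊ = 0 := Nat.ceil_eq_zero.2 (by
        have := Real.log_nonpos hy.le h
        linarith)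
      simp [this, hy.le]
    · have h1 := Nat.ceil_lt_add_one (R := ℝ) (a := 16 * Real.log y) (by
        have := Real.log_nonneg h
        linarith)
      have h2 : Real.exp (⌈16 * Real.log y⌉₊ / 16) ≤ Real.exp (Real.log y + 1 / 16) := by
        gcongr
        linarith
      have h3 : Real.exp (1 / 16) ≤ 2 := by
        have h4 := fifteen_sixteenths_le_exp
        rw [Real.exp_neg] at h4
        have := inv_anti₀ (by norm_num) h4
        rw [inv_inv] at this
        norm_num at this ⊢
        linarith
      rw [Real.exp_add, Real.exp_log hy] at h2
      have := mul_le_mul_of_nonneg_left h3 hy.le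
      linarith
  · have hlog : 0 ≤ Real.log (1 + y) := Real.log_nonneg (by linarith)
    have h1 : (⌈16 * Real.log y⌉₊ : ℝ) ≤ ⌈16 * Real.log (1 + y)⌉₊ := by
      gcongr
      linarith
    exact h1.trans (Nat.ceil_lt_add_one (by positivity)).le

/-- The total number of iterations in terms of the reduction factor `c * X`. -/
theorem iteration_count_le {c X a : ℝ} (hc : 1 ≤ c) (hX : 0 < X) (ha : 0 ≤ a) {N K : ℝ}
    (hN : N ≤ 12288 * a * (Real.exp (K / 16) - 1) + K) (hK : Real.exp (K / 16) - 1 ≤ 2 * (c * X))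
    (hK' : K ≤ 16 * Real.log (1 + c * X) + 1) :
    N ≤ 24576 * c * (a * X) + 16 * c + 16 * Real.log (1 + X) + 1 := by
  have h1 : Real.log (1 + c * X) ≤ c + Real.log (1 + X) := by
    calc Real.log (1 + c * X) ≤ Real.log (c * (1 + X)) := by
          apply Real.log_le_log (by positivity)
          linarith
      _ = Real.log c + Real.log (1 + X) := Real.log_mul (by positivity) (by positivity)
      _ ≤ _ := by
          have := Real.log_le_self (show 0 ≤ c by linarith)
          linarith
  have h2 := mul_le_mul_of_nonneg_left hK (show 0 ≤ 12288 * a by positivity)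
  linarith

end Count

/-! ### The complexity bound -/

theorem mainTheorem9 :
    ∃ C : ℝ, 0 < C ∧
      ∀ (μ μx μy ρ B ε₀ η₀ : ℝ), 0 < μ → 0 < μx → 0 < μy → 0 < ρ → ρ ≤ μ / 8 → 0 < B →
        0 ≤ ε₀ → 0 < η₀ → η₀ ≤ 1 / ρ →
      ∃ εbar : ℝ, 0 < εbar ∧ ∀ ε : ℝ, 0 < ε → ∃ K : ℕ,
        -- iteration count for small accuracy
        (ε ≤ εbar →
          ((∑ k ∈ Finset.Icc 1 K, epochLength η₀ μ μy k : ℕ) : ℝ)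
            ≤ C * ((μ / μx + 1) * B ^ 2 / (min μ μy * ε)) * Real.log (1 / ε)) ∧
        -- iteration count for arbitrary accuracy
        ((∑ k ∈ Finset.Icc 1 K, epochLength η₀ μ μy k : ℕ) : ℝ)
            ≤ C * (1 + (μ / μx + 1) * max (ε₀ / η₀) (B ^ 2) / (min μ μy * ε))
                * (1 + Real.log (1 + (μ / μx + 1) * (ε₀ + η₀ * B ^ 2) / ε)) ∧
        -- accuracy of the output after `K` epochs
        ∀ (d d' : ℕ) (Y : Set (EuclideanSpace ℝ (Fin d')))
          (f : EuclideanSpace ℝ (Fin d) → EuclideanSpace ℝ (Fin d') → ℝ) (ell L : ℝ)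
          (x₀ : EuclideanSpace ℝ (Fin d)) (y₀ : EuclideanSpace ℝ (Fin d'))
          (S Ω : Type*) [MeasurableSpace S] [MeasurableSpace Ω]
          (Pr : Measure Ω) [IsProbabilityMeasure Pr]
          (Gx : EuclideanSpace ℝ (Fin d) → EuclideanSpace ℝ (Fin d') → S →
            EuclideanSpace ℝ (Fin d))
          (Gy : EuclideanSpace ℝ (Fin d) → EuclideanSpace ℝ (Fin d') → S →
            EuclideanSpace ℝ (Fin d'))
          (ξ : ℕ → ℕ → Ω → S),
          MinMaxAssumptions f Y ell L ρ μ μx μy →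
          y₀ ∈ Y → dualityGap f Y x₀ y₀ ≤ ε₀ →
          IsUnbiasedOracle Pr f Y Gx Gy ξ →
          BoundedGradientsAlongRun Pr B Y Gx Gy (μ / 4) (stepSize η₀) (epochLength η₀ μ μy)
            (x₀, y₀) ξ →
          let z : Ω → EuclideanSpace ℝ (Fin d) × EuclideanSpace ℝ (Fin d') := fun ω =>
            pesIter Y Gx Gy (μ / 4) (stepSize η₀) (epochLength η₀ μ μy) (x₀, y₀)
              (fun i j => ξ i j ω) K
          Integrable (fun ω => dualityGap f Y (z ω).1 (z ω).2) Pr ∧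
            ∫ ω, dualityGap f Y (z ω).1 (z ω).2 ∂Pr ≤ ε := by
  set c : ℝ := 6000000 with hc
  have hc1 : 1 ≤ c := by norm_num [hc]
  refine ⟨400000 * c, by positivity, fun μ μx μy ρ B ε₀ η₀ hμ hμx hμy hρ hρμ hB hε₀ hη₀ hηρ => ?_⟩
  set κ := μ / μx + 1 with hκ
  have hκ0 : 0 < κ := by positivity
  set m := min μ μy with hm
  have hm0 : 0 < m := lt_min hμ hμy
  set M := min (μ / 8) μy with hM
  have hM0 : 0 < M := lt_min (by positivity) hμy
  have hmM : m / 8 ≤ M := by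
    refine le_min ?_ ?_
    · have := min_le_left μ μy
      linarith
    · have := min_le_right μ μy
      linarith
  set R := κ * (ε₀ + η₀ * B ^ 2) with hR
  have hR0 : 0 < R := by positivity
  have hηB : 0 < η₀ * B ^ 2 := by positivity
  -- Below the first bound κB²/(mε) ≥ 1, which absorbs additive constants and logarithms. Below the
  -- second, log(1/ε) exceeds 1 + ε₀/(η₀B²) + log(1 + R), so one logarithm absorbs both the initial
  -- gap and the scale R.
  refine ⟨min (κ * B ^ 2 / m) (Real.exp (-(1 + ε₀ / (η₀ * B ^ 2) + Real.log (1 + R)))),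
    lt_min (by positivity) (Real.exp_pos _), fun ε hε => ?_⟩
  have hX : 0 < R / ε := by positivity
  obtain ⟨K, hK1, hK2, hK3⟩ := exists_epoch_count (y := c * (R / ε)) (by positivity)
  have ha : 0 ≤ 1 / (η₀ * M) := by positivity
  have hcount := iteration_count_le (N := ((∑ k ∈ Finset.Icc 1 K, epochLength η₀ μ μy k : ℕ) : ℝ))
    hc1 hX ha
    ((sum_epochLength_le hη₀ hμ hμy K).trans_eq (by rw [← hM]; ring)) hK2 hK3
  have haX : 1 / (η₀ * M) * (R / ε) ≤ 8 * (κ * (ε₀ / η₀ + B ^ 2) / (m * ε)) := by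
    have h1 : 1 / (η₀ * M) * (R / ε) = κ * (ε₀ / η₀ + B ^ 2) / (M * ε) := by
      rw [hR]; field_simp
    have h2 : 8 * (κ * (ε₀ / η₀ + B ^ 2) / (m * ε)) = κ * (ε₀ / η₀ + B ^ 2) / (m / 8 * ε) := by
      field_simp
    rw [h1, h2]
    gcongr
  have hℓ : 0 ≤ Real.log (1 + R / ε) := Real.log_nonneg (by linarith)
  refine ⟨K, fun hsmall => ?_, ?_, ?_⟩
  · have hs1 := hsmall.trans (min_le_left _ _)
    have hs2 := hsmall.trans (min_le_right _ _)
    set Q := κ * B ^ 2 / (m * ε) with hQ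
    set Λ := Real.log (1 / ε) with hΛ
    have hQ1 : 1 ≤ Q := by
      rw [hQ, one_le_div (by positivity)]
      rwa [le_div_iff₀ hm0, mul_comm] at hs1
    have hr : 0 ≤ ε₀ / (η₀ * B ^ 2) := by positivity
    have hl : 0 ≤ Real.log (1 + R) := Real.log_nonneg (by linarith)
    have hΛ1 : 1 + ε₀ / (η₀ * B ^ 2) + Real.log (1 + R) ≤ Λ := by
      have := Real.log_le_log hε hs2
      rw [Real.log_exp] at this
      rw [hΛ, one_div, Real.log_inv]
      linarith
    have hε1 : ε ≤ 1 := hs2.trans (Real.exp_le_one_iff.2 (by linarith))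
    have h1 : κ * (ε₀ / η₀ + B ^ 2) / (m * ε) ≤ Q * Λ := by
      have : κ * (ε₀ / η₀ + B ^ 2) / (m * ε) = Q * (1 + ε₀ / (η₀ * B ^ 2)) := by
        rw [hQ]; field_simp; ring
      rw [this]
      gcongr
      linarith
    have h2 : Real.log (1 + R / ε) ≤ 2 * Λ := by
      calc Real.log (1 + R / ε) ≤ Real.log ((1 + R) * (1 / ε)) := by
            apply Real.log_le_log (by positivity)
            have : 1 ≤ 1 / ε := by rwa [one_le_div hε]
            rw [add_mul, mul_one_div R, one_mul]
            exact add_le_add_left this _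
        _ = Real.log (1 + R) + Λ := Real.log_mul (by positivity) (by positivity)
        _ ≤ 2 * Λ := by linarith
    have h3 : Λ ≤ Q * Λ := le_mul_of_one_le_left (by linarith) hQ1
    have h4 : 24576 * c * (1 / (η₀ * M) * (R / ε)) ≤ 24576 * c * (8 * (Q * Λ)) := by
      exact mul_le_mul_of_nonneg_left (haX.trans (mul_le_mul_of_nonneg_left h1 (by norm_num)))
        (by positivity)
    have h5 : c ≤ c * (Q * Λ) := le_mul_of_one_le_right (by linarith) (by linarith)
    have h6 : Q * Λ ≤ c * (Q * Λ) := le_mul_of_one_le_left (by linarith) hc1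
    linarith
  · set Q := κ * max (ε₀ / η₀) (B ^ 2) / (m * ε) with hQ
    set ℓ := Real.log (1 + R / ε)
    have hQ0 : 0 ≤ Q := by positivity
    have h1 : κ * (ε₀ / η₀ + B ^ 2) / (m * ε) ≤ 2 * Q := by
      rw [hQ, ← mul_div_assoc]
      refine div_le_div_of_nonneg_right ?_ (by positivity)
      have i1 := mul_le_mul_of_nonneg_left (le_max_left (ε₀ / η₀) (B ^ 2)) hκ0.le
      have i2 := mul_le_mul_of_nonneg_left (le_max_right (ε₀ / η₀) (B ^ 2)) hκ0.le
      linarith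
    have h4 : 24576 * c * (1 / (η₀ * M) * (R / ε)) ≤ 24576 * c * (16 * Q) :=
      mul_le_mul_of_nonneg_left (haX.trans (by linarith)) (by positivity)
    have h5 : ℓ ≤ c * ℓ := le_mul_of_one_le_left hℓ hc1
    have h6 : 0 ≤ c * Q := by positivity
    have h7 : 0 ≤ c * (Q * ℓ) := by positivity
    linarith
  · intro d d' Y f ell L x₀ y₀ S Ω _ _ Pr _ Gx Gy ξ hf hy₀ hgap ho hBd
    obtain ⟨γ, rfl⟩ : ∃ γ, μ = 4 * γ := ⟨μ / 4, by ring⟩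
    rw [show 4 * γ / 4 = γ by ring] at hBd ⊢
    have h := hf.integral_dualityGap_pesIter_le (z₀ := (x₀, y₀)) hμx hμy (by linarith) hρ
      (by linarith) hε₀ hη₀ hηρ hy₀ hgap ho hBd K
    refine ⟨h.1, h.2.trans ?_⟩
    have e : 6000000 * (4 * γ / μx + 1) * (ε₀ + η₀ * B ^ 2) * Real.exp (-(1 / 16)) ^ K
        = ε * (c * (R / ε) * Real.exp (-(1 / 16)) ^ K) := by
      rw [hR, hκ, hc]; field_simp
    rw [e]
    exact mul_le_of_le_one_right hε.le hK1
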